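/- **Setting.** Let $(\Omega,\mathcal F,P)$ be a complete, nonatomic probability space, $\Xi$ a complete separable metric space with its Borel $\sigma$-algebra, and $\xi,\xi^1,\xi^2,\dots:\Omega\to\Xi$ random elements, where $\xi^1,\xi^2,\dots$ are independent and each has the law of $\xi$. Let $p\in[1,\infty)$. Let $Z$ be a separable reflexive Banach space, $Z_{\rm ad}\subset Z$ nonempty, closed, convex and bounded, $Y$ a Banach space, $Y_0\subset Y$ closed, and $\mathbf B:Z\to Y$ linear and completely continuous (i.e. $z_k\rightharpoonup z$ implies $\mathbf B z_k\to\mathbf B z$) with $\mathbf B(Z_{\rm ad})\subset Y_0$. Let $\wp:Z\to[0,\infty)$ be convex and continuous. Let $f:Y_0\times\Xi\to\mathbb R$ be a Carathéodory function: $f(\cdot,x)$ is continuous for every $x\in\Xi$, and $f(y,\cdot)$ is measurable for every $y\in Y_0$ (with respect to the Borel $\sigma$-algebra completed under the law of $\xi$). Put $F(y)(\omega)=f(y,\xi(\omega))$ and suppose that $F(y)\in L^p(\Omega,\mathcal F,P)$ for all $y\in Y_0$, that $F:Y_0\to L^p(\Omega,\mathcal F,P)$ is continuous, and that every $\bar y\in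 Y_0$ has a neighborhood $\mathcal V$ and an $h\in L^p(\Omega,\mathcal F,P)$ such that $F(y)\ge h$ almost surely for each $y\in\mathcal V\cap Y_0$. For $\beta\in[0,1)$, $\varepsilon>0$ and $X\in L^p(\Omega,\mathcal F,P)$ let $$\mathrm{AVaR}_\beta[X]=\inf_{t\in\mathbb R}\Big\{t+\tfrac1{1-\beta}\mathbb E[\max\{0,X-t\}]\Big\},\qquad \mathrm{AVaR}_{\beta}^{\varepsilon}[X]=\inf_{t\in\mathbb R}\Big\{t+\tfrac1{1-\beta}\mathbb E\big[\varepsilon\ln(1+e^{(X-t)/\varepsilon})\big]\Big\}.$$ These functionals are law invariant; for a distribution function $H$, $\mathrm{AVaR}_\beta^\varepsilon[H]$ denotes the value at any $X\in L^p(\Omega,\mathcal F,P)$ with distribution function $H$. For $N\ge1$ let $\hat H_{y,N}=\hat H_{y,N,\omega}$ be the empirical distribution function of $f(y,\xi^1(\omega)),\dots,f(y,\xi^N(\omega))$. Let $m^*$ and $\mathscr S$ be the optimal value and the solution set of $$\min_{z\in Z_{\rm ad}}\ \mathrm{AVaR}_\beta[F(\mathbf B z)]+\wp(z),$$ and let $\hat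 m^{\varepsilon}_{{\rm s},N}$ and $\hat{\mathscr S}^{\varepsilon}_{{\rm s},N}$ be the optimal value and the solution set of $$\min_{z\in Z_{\rm ad}}\ \mathrm{AVaR}^{\varepsilon}_\beta[\hat H_{\mathbf B z,N}]+\wp(z).$$ **Proposition.** Let $(\varepsilon_N)\subset(0,\infty)$ with $\varepsilon_N\to0$. Then $m^*$ is finite, $\mathscr S$ is nonempty, almost surely $\hat{\mathscr S}^{\varepsilon_N}_{{\rm s},N}$ is nonempty for all $N\ge1$, and $$\hat m^{\varepsilon_N}_{{\rm s},N}\to m^*\quad\text{almost surely as }N\to\infty.$$ If furthermore $\wp$ is an R-function (i.e. $\wp:Z\to[0,\infty)$ is convex and continuous, and $z_k\rightharpoonup z$ together with $\wp(z_k)\to\wp(z)$ implies $z_k\to z$ in norm), then $$\sup_{z\in\hat{\mathscr S}^{\varepsilon_N}_{{\rm s},N}}\ \inf_{z'\in\mathscr S}\|z-z'\|_Z\to0\quad\text{almost surely as }N\to\infty.$$ -/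

import Mathlib

open MeasureTheory ProbabilityTheory Filter Topology Set
open scoped ENNReal

namespace RiskConsistency

noncomputable section

/-! ### Functional analysis -/

/-- A normed space is reflexive if its canonical embedding into the bidual is onto. -/
def ReflexiveSpace (V : Type*) [NormedAddCommGroup V] [NormedSpace ℝ V] : Prop :=
  Function.Surjective (NormedSpace.inclusionInDoubleDual ℝ V)

/-- Weak convergence `v k ⇀ v₀` of a sequence. -/
def WeakTendsto {V : Type*} [NormedAddCommGroup V] [NormedSpace ℝ V]
    (v : ℕ → V) (v₀ : V) : Prop :=
  ∀ φ : V →L[ℝ] ℝ, Tendsto (fun k => φ (v k)) atTop (𝓝 (φ v₀))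

/-- A map is completely continuous if it sends weakly convergent sequences to
norm-convergent sequences (with the corresponding limit). -/
def CompletelyContinuous {V W : Type*} [NormedAddCommGroup V] [NormedSpace ℝ V]
    [TopologicalSpace W] (G : V → W) : Prop :=
  ∀ (v : ℕ → V) (v₀ : V), WeakTendsto v v₀ → Tendsto (fun k => G (v k)) atTop (𝓝 (G v₀))

/-- An R-function: convex, continuous, nonnegative, and such that weak convergence together with
convergence of the function values implies norm convergence. -/
structure IsRFunction {V : Type*} [NormedAddCommGroup V] [NormedSpace ℝ V]
    (φ : V → ℝ) : Prop where
  nonneg : ∀ v, 0 ≤ φ v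
  convex : ConvexOn ℝ univ φ
  continuous : Continuous φ
  tendsto_of_weak : ∀ (v : ℕ → V) (v₀ : V), WeakTendsto v v₀ →
    Tendsto (fun k => φ (v k)) atTop (𝓝 (φ v₀)) → Tendsto v atTop (𝓝 v₀)

/-- The deviation `sup_{x ∈ Γ} inf_{y ∈ Ψ} ‖x - y‖`, with values in `[0, ∞]`. -/
def deviation {V : Type*} [NormedAddCommGroup V] (Γ Ψ : Set V) : ℝ≥0∞ :=
  ⨆ x ∈ Γ, ⨅ y ∈ Ψ, ENNReal.ofReal ‖x - y‖

/-! ### Optimization problems -/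

/-- The optimal value `inf_{z ∈ A} J z`, as an extended real number. -/
def optVal {V : Type*} (J : V → ℝ) (A : Set V) : EReal :=
  ⨅ z ∈ A, (J z : EReal)

/-- The solution set of `min_{z ∈ A} J z`. -/
def solSet {V : Type*} (J : V → ℝ) (A : Set V) : Set V :=
  {z ∈ A | (J z : EReal) = optVal J A}

/-! ### Probability -/

/-- A measure is nonatomic if every measurable set of positive measure has a measurable subset of
positive and strictly smaller measure. (Mathlib's `NoAtoms` only concerns singletons.) -/
def Nonatomic {Ω : Type*} [MeasurableSpace Ω] (P : Measure Ω) : Prop :=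
  ∀ s, MeasurableSet s → 0 < P s → ∃ t ⊆ s, MeasurableSet t ∧ 0 < P t ∧ P t < P s

/-- The distribution function `t ↦ P(X ≤ t)`. -/
def distFun {Ω : Type*} [MeasurableSpace Ω] (P : Measure Ω) (X : Ω → ℝ) (t : ℝ) : ℝ :=
  P.real {ω | X ω ≤ t}

/-- The empirical distribution function of the sample `x 0, …, x (N - 1)`. -/
def empDistFun (x : ℕ → ℝ) (N : ℕ) (t : ℝ) : ℝ :=
  (1 / (N : ℝ)) * ∑ i ∈ Finset.range N, (Iic t).indicator (fun _ => (1 : ℝ)) (x i)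

/-- A functional on `L^p(P)` is law invariant if it takes equal values at random variables with
equal distribution functions. -/
def LawInvariant {Ω : Type*} [MeasurableSpace Ω] (P : Measure Ω) (p : ℝ≥0∞)
    (ρ : (Ω → ℝ) → ℝ) : Prop :=
  ∀ X X' : Ω → ℝ, MemLp X p P → MemLp X' p P → distFun P X = distFun P X' → ρ X = ρ X'

open Classical in
/-- The value `ρ[H]` of a law invariant functional `ρ` on `L^p(P)` at a distribution function `H`:
the common value of `ρ` at the random variables in `L^p(P)` with distribution function `H`. If `P`
is nonatomic, such random variables exist for the empirical distribution function `H` of any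
nonempty sample; the value `0` is used if there are none. -/
def riskAt {Ω : Type*} [MeasurableSpace Ω] (P : Measure Ω) (p : ℝ≥0∞)
    (ρ : (Ω → ℝ) → ℝ) (H : ℝ → ℝ) : ℝ :=
  if h : ∃ X : Ω → ℝ, MemLp X p P ∧ distFun P X = H then ρ h.choose else 0

/-- `ρ[H]` does not depend on the choice of the random variable. -/
theorem riskAt_distFun {Ω : Type*} [MeasurableSpace Ω] {P : Measure Ω} {p : ℝ≥0∞}
    {ρ : (Ω → ℝ) → ℝ} (hρ : LawInvariant P p ρ) {X : Ω → ℝ} (hX : MemLp X p P) :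
    riskAt P p ρ (distFun P X) = ρ X := by
  have h : ∃ X' : Ω → ℝ, MemLp X' p P ∧ distFun P X' = distFun P X := ⟨X, hX, rfl⟩
  rw [riskAt, dif_pos h]
  exact hρ _ _ h.choose_spec.1 hX h.choose_spec.2

/-! ### Average value-at-risk and its smoothing -/

/-- The average value-at-risk at level `β`. -/
def avar {Ω : Type*} [MeasurableSpace Ω] (P : Measure Ω) (β : ℝ) (X : Ω → ℝ) : ℝ :=
  ⨅ t : ℝ, (t + 1 / (1 - β) * ∫ ω, max 0 (X ω - t) ∂P)

/-- The log-exp smoothing of the plus function `x ↦ max 0 x`. -/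
def smoothedPlus (ε x : ℝ) : ℝ :=
  ε * Real.log (1 + Real.exp (x / ε))

/-- The smoothed average value-at-risk at level `β` with smoothing parameter `ε`. -/
def smoothedAvar {Ω : Type*} [MeasurableSpace Ω] (P : Measure Ω) (β ε : ℝ) (X : Ω → ℝ) : ℝ :=
  ⨅ t : ℝ, (t + 1 / (1 - β) * ∫ ω, smoothedPlus ε (X ω - t) ∂P)

theorem integral_comp_eq_of_distFun_eq {Ω : Type*} [MeasurableSpace Ω] {P : Measure Ω}
    [IsProbabilityMeasure P] {X X' : Ω → ℝ} (hX : AEMeasurable X P) (hX' : AEMeasurable X' P)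
    (h : distFun P X = distFun P X') {g : ℝ → ℝ} (hg : Continuous g) :
    ∫ ω, g (X ω) ∂P = ∫ ω, g (X' ω) ∂P := by
  have hmap : P.map X = P.map X' := by
    have := Measure.isProbabilityMeasure_map hX
    have := Measure.isProbabilityMeasure_map hX'
    refine Measure.ext_of_Iic _ _ fun t => ?_
    rw [Measure.map_apply_of_aemeasurable hX measurableSet_Iic,
      Measure.map_apply_of_aemeasurable hX' measurableSet_Iic]
    have ht := congrFun h t
    exact (measureReal_eq_measureReal_iff).1 ht
  rw [← integral_map hX hg.aestronglyMeasurable, hmap,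
    integral_map hX' hg.aestronglyMeasurable]

theorem lawInvariant_avar {Ω : Type*} [MeasurableSpace Ω] (P : Measure Ω)
    [IsProbabilityMeasure P] (p : ℝ≥0∞) (β : ℝ) : LawInvariant P p (avar P β) := by
  intro X X' hX hX' h
  unfold avar
  congr 1
  funext t
  rw [integral_comp_eq_of_distFun_eq (g := fun x => max 0 (x - t))
    hX.aestronglyMeasurable.aemeasurable hX'.aestronglyMeasurable.aemeasurable h (by fun_prop)]

theorem lawInvariant_smoothedAvar {Ω : Type*} [MeasurableSpace Ω] (P : Measure Ω)
    [IsProbabilityMeasure P] (p : ℝ≥0∞) (β ε : ℝ) : LawInvariant P p (smoothedAvar P β ε) := by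
  intro X X' hX hX' h
  unfold smoothedAvar
  congr 1
  funext t
  have hc : Continuous fun x : ℝ => smoothedPlus ε (x - t) := by
    unfold smoothedPlus
    refine continuous_const.mul (Continuous.log (by fun_prop) fun x => ?_)
    positivity
  rw [integral_comp_eq_of_distFun_eq (g := fun x => smoothedPlus ε (x - t))
    hX.aestronglyMeasurable.aemeasurable hX'.aestronglyMeasurable.aemeasurable h hc]

/-! ### The objective functions -/

/-- The objective `z ↦ AVaR[F(B z)] + ℘(z)`, where `F(y)(ω) = f(y, ξ(ω))`. -/
def trueObj {Ω Ξ Z Y : Type*} [MeasurableSpace Ω] (P : Measure Ω) (β : ℝ)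
    (ξ : Ω → Ξ) (f : Y → Ξ → ℝ) (B : Z → Y) (wp : Z → ℝ) (z : Z) : ℝ :=
  avar P β (fun ω => f (B z) (ξ ω)) + wp z

/-- The smoothed empirical objective `z ↦ AVaR_ε[Ĥ_{B z, N, ω}] + ℘(z)`, where `Ĥ_{y, N, ω}` is the
empirical distribution function of the sample `f(y, ξ_i(ω))`, `i < N`. -/
def smoothedEmpObj {Ω Ξ Z Y : Type*} [MeasurableSpace Ω] (P : Measure Ω) (p : ℝ≥0∞) (β ε : ℝ)
    (ξs : ℕ → Ω → Ξ) (f : Y → Ξ → ℝ) (B : Z → Y) (wp : Z → ℝ) (N : ℕ) (ω : Ω) (z : Z) : ℝ :=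
  riskAt P p (smoothedAvar P β ε) (empDistFun (fun i => f (B z) (ξs i ω)) N) + wp z

end

end RiskConsistency

open RiskConsistency

/-! Complete continuity makes `K = B '' Zad` norm compact, so both objectives are a continuous
function of `B z` plus a weakly lower semicontinuous cost, and the direct method yields minimizers.
Consistency needs no two-sided uniform law of large numbers. From below, near each `y₀ ∈ K` the
integrand dominates a single integrable envelope `g` with almost the same AVaR as at `y₀`.
Monotonicity and the law of large numbers for `g` give a local lower bound, and a finite cover makes
it uniform on `K` (`ae_eventually_sub_le_avar_empMeasure`). From above, pointwise convergence at one
true solution is enough. Smoothing changes AVaR by an amount between `0` and `ε * log 2 / (1 - β)`.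
Hence the optimal values are squeezed, and empirical solutions are near-minimizers of the true
problem. For an R-function these are norm-close to true solutions (`exists_near_minimizer`).
Nonatomicity allows an empirical distribution to be realized on `Ω`, so `riskAt` becomes a
functional of the uniform measure on the indices. -/

namespace RiskConsistency

/-! ### Weak compactness and the direct method. -/

section FunctionalAnalysis

variable {Z : Type*} [NormedAddCommGroup Z] [NormedSpace ℝ Z]

/-- In a separable normed space, countably many functionals separate points. -/
theorem exists_countable_separating_functionals [TopologicalSpace.SeparableSpace Z] :
    ∃ g : ℕ → Z →L[ℝ] ℝ, ∀ x y : Z, x ≠ y → ∃ n, g n x ≠ g n y := by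
  choose g hg1 hg2 using fun x : Z => exists_dual_vector'' ℝ x
  refine ⟨fun n => g (TopologicalSpace.denseSeq Z n), fun x y hxy => ?_⟩
  by_contra! h
  have hd : 0 < ‖x - y‖ := norm_pos_iff.2 (sub_ne_zero.2 hxy)
  -- If the norming functional of a `d` this close to `x - y` vanished at `x - y`, then `‖d‖ ≤ ‖d -
  -- (x - y)‖ < ‖x - y‖ / 2`, against the triangle inequality.
  obtain ⟨n, hn⟩ := (TopologicalSpace.denseRange_denseSeq Z).exists_dist_lt (x - y)
    (half_pos hd)
  set d := TopologicalSpace.denseSeq Z n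
  have h0 : g d (x - y) = 0 := by rw [map_sub, h n, sub_self]
  have h1 : g d d = ‖d‖ := by simpa using hg2 d
  have h2 : g d (d - (x - y)) ≤ ‖d - (x - y)‖ :=
    (le_abs_self _).trans <| by
      simpa using (g d).le_of_opNorm_le (hg1 d) (d - (x - y))
  rw [map_sub, h0, h1, sub_zero] at h2
  rw [dist_eq_norm, norm_sub_rev] at hn
  have h3 : ‖x - y‖ ≤ ‖d‖ + ‖d - (x - y)‖ := by
    have := norm_sub_le d (d - (x - y))
    simpa using this
  linarith

/-- Reflexivity makes the weak closure of a bounded set compact. Countably many separating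
functionals metrize it, so compactness is sequential. -/
theorem ReflexiveSpace.exists_weakTendsto_subseq [TopologicalSpace.SeparableSpace Z]
    (hZ : ReflexiveSpace Z) {s : Set Z} (hs : Bornology.IsBounded s) {v : ℕ → Z}
    (hv : ∀ n, v n ∈ s) :
    ∃ (v₀ : Z) (k : ℕ → ℕ), StrictMono k ∧ WeakTendsto (v ∘ k) v₀ := by
  set S : Set (WeakSpace ℝ Z) := toWeakSpace ℝ Z '' s with hS
  have hcomp : IsCompact (closure S) := by
    refine NormedSpace.isCompact_closure_of_isBounded ℝ Z S ?_ fun x _ => ?_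
    · rwa [hS, Set.preimage_image_eq _ (toWeakSpace ℝ Z).injective]
    · obtain ⟨z, hz⟩ := hZ (WeakDual.toStrongDual x)
      exact ⟨toWeakSpace ℝ Z z, DFunLike.ext _ _ fun φ => DFunLike.congr_fun hz φ⟩
  obtain ⟨g, hg⟩ := exists_countable_separating_functionals (Z := Z)
  have : CompactSpace (closure S) := isCompact_iff_compactSpace.mp hcomp
  have hgc : ∀ φ : Z →L[ℝ] ℝ, Continuous fun x : WeakSpace ℝ Z =>
      φ ((toWeakSpace ℝ Z).symm x) := fun φ => WeakBilin.eval_continuous _ φ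
  have : TopologicalSpace.MetrizableSpace (closure S) :=
    Metric.PiNatEmbed.TopologicalSpace.MetrizableSpace.of_countable_separating
      (fun n (x : closure S) => g n ((toWeakSpace ℝ Z).symm x.1))
      (fun n => (hgc (g n)).comp continuous_subtype_val)
      fun x y hxy => hg _ _ ((toWeakSpace ℝ Z).symm.injective.ne (Subtype.val_injective.ne hxy))
  obtain ⟨a, k, hk, ha⟩ := SeqCompactSpace.tendsto_subseq
    (fun n => (⟨toWeakSpace ℝ Z (v n), subset_closure ⟨_, hv n, rfl⟩⟩ : closure S))
  refine ⟨(toWeakSpace ℝ Z).symm a.1, k, hk, fun φ => ?_⟩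
  exact (((hgc φ).comp continuous_subtype_val).tendsto a).comp ha

/-- A closed convex set is weakly sequentially closed. -/
theorem WeakTendsto.mem_of_frequently {v : ℕ → Z} {v₀ : Z} (h : WeakTendsto v v₀) {s : Set Z}
    (hs : Convex ℝ s) (hc : IsClosed s) (hv : ∃ᶠ n in atTop, v n ∈ s) : v₀ ∈ s := by
  by_contra hv₀
  obtain ⟨φ, u, hu, hφ⟩ := geometric_hahn_banach_closed_point hs hc hv₀
  refine hv ?_
  filter_upwards [(h φ).eventually (lt_mem_nhds hφ)] with n hn hmem
  exact absurd (hu _ hmem) (not_lt.2 hn.le)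

/-- Weak lower semicontinuity: sublevel sets are convex and closed, hence weakly sequentially
closed. -/
theorem WeakTendsto.le_of_tendsto {v : ℕ → Z} {v₀ : Z} (h : WeakTendsto v v₀) {φ : Z → ℝ}
    (hφ : ConvexOn ℝ univ φ) (hφc : Continuous φ) {a : ℝ}
    (ha : Tendsto (fun n => φ (v n)) atTop (𝓝 a)) : φ v₀ ≤ a := by
  refine le_of_forall_pos_le_add fun η hη => ?_
  have hconv : Convex ℝ {z | φ z ≤ a + η} := by simpa using hφ.convex_le (a + η)
  refine h.mem_of_frequently hconv (isClosed_le hφc continuous_const) (Eventually.frequently ?_)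
  filter_upwards [ha.eventually (gt_mem_nhds (lt_add_of_pos_right a hη))] with n hn using hn.le

variable {Y : Type*} {s : Set Z} {B : Z → Y}

theorem ReflexiveSpace.isCompact_image [TopologicalSpace.SeparableSpace Z]
    (hZ : ReflexiveSpace Z) [PseudoMetricSpace Y] (hs : Bornology.IsBounded s)
    (hs_conv : Convex ℝ s) (hs_closed : IsClosed s) (hB : CompletelyContinuous B) :
    IsCompact (B '' s) := by
  rw [isCompact_iff_isSeqCompact]
  intro y hy
  choose z hzs hzy using hy
  obtain ⟨z₀, k, hk, hz⟩ := hZ.exists_weakTendsto_subseq hs hzs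
  refine ⟨B z₀, mem_image_of_mem _ (hz.mem_of_frequently hs_conv hs_closed
    (Frequently.of_forall fun n => hzs _)), k, hk, ?_⟩
  simpa only [Function.comp_def, hzy] using hB _ _ hz

/-- Minimizing sequences of `A ∘ B + φ` over `s` have weak limit points that are minimizers, and
the values of `φ` converge along the subsequence. -/
theorem ReflexiveSpace.exists_subseq_of_minimizing [TopologicalSpace.SeparableSpace Z]
    (hZ : ReflexiveSpace Z) [TopologicalSpace Y] (hs : Bornology.IsBounded s)
    (hs_conv : Convex ℝ s) (hs_closed : IsClosed s) (hB : CompletelyContinuous B)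
    {A : Y → ℝ} (hA : ContinuousOn A (B '' s)) {φ : Z → ℝ} (hφ : ConvexOn ℝ univ φ)
    (hφc : Continuous φ) {m : ℝ} (hm : ∀ z ∈ s, m ≤ A (B z) + φ z) {v : ℕ → Z}
    (hv : ∀ n, v n ∈ s) (hvm : Tendsto (fun n => A (B (v n)) + φ (v n)) atTop (𝓝 m)) :
    ∃ (v₀ : Z) (k : ℕ → ℕ), v₀ ∈ s ∧ StrictMono k ∧ A (B v₀) + φ v₀ = m ∧
      WeakTendsto (v ∘ k) v₀ ∧ Tendsto (fun n => φ (v (k n))) atTop (𝓝 (φ v₀)) := by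
  obtain ⟨v₀, k, hk, hw⟩ := hZ.exists_weakTendsto_subseq hs hv
  have hv₀ : v₀ ∈ s := hw.mem_of_frequently hs_conv hs_closed (Frequently.of_forall fun n => hv _)
  have hA' : Tendsto (fun n => A (B (v (k n)))) atTop (𝓝 (A (B v₀))) :=
    (hA _ (mem_image_of_mem _ hv₀)).tendsto.comp <| tendsto_nhdsWithin_iff.2
      ⟨hB _ _ hw, Eventually.of_forall fun n => mem_image_of_mem _ (hv _)⟩
  -- As the `A ∘ B` part converges, so does the remaining `φ` part. Semicontinuity bounds `φ v₀` by
  -- its limit, and minimality of `m` forces equality.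
  have hφ' : Tendsto (fun n => φ (v (k n))) atTop (𝓝 (m - A (B v₀))) := by
    simpa using (hvm.comp hk.tendsto_atTop).sub hA'
  have hle := hw.le_of_tendsto hφ hφc hφ'
  have heq : φ v₀ = m - A (B v₀) := le_antisymm hle (by linarith [hm v₀ hv₀])
  exact ⟨v₀, k, hv₀, hk, by linarith, hw, heq ▸ hφ'⟩

theorem ReflexiveSpace.exists_minimizer [TopologicalSpace.SeparableSpace Z]
    (hZ : ReflexiveSpace Z) [PseudoMetricSpace Y] (hs_ne : s.Nonempty)
    (hs : Bornology.IsBounded s)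
    (hs_conv : Convex ℝ s) (hs_closed : IsClosed s) (hB : CompletelyContinuous B)
    {A : Y → ℝ} (hA : ContinuousOn A (B '' s)) {φ : Z → ℝ} (hφ0 : ∀ z, 0 ≤ φ z)
    (hφ : ConvexOn ℝ univ φ) (hφc : Continuous φ) :
    ∃ z ∈ s, ∀ z' ∈ s, A (B z) + φ z ≤ A (B z') + φ z' := by
  obtain ⟨b, hb⟩ := ((hZ.isCompact_image hs hs_conv hs_closed hB).image_of_continuousOn hA).bddBelow
  set J : Z → ℝ := fun z => A (B z) + φ z
  have hbdd : BddBelow (J '' s) := ⟨b, by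
    rintro _ ⟨z, hz, rfl⟩
    have := hb (mem_image_of_mem A (mem_image_of_mem B hz))
    exact this.trans (le_add_of_nonneg_right (hφ0 z))⟩
  obtain ⟨u, -, hu, hus⟩ := exists_seq_tendsto_sInf (hs_ne.image J) hbdd
  choose v hv hvu using hus
  have hm : ∀ z ∈ s, sInf (J '' s) ≤ A (B z) + φ z := fun z hz =>
    csInf_le hbdd (mem_image_of_mem J hz)
  obtain ⟨v₀, k, hv₀, -, hval, -⟩ := hZ.exists_subseq_of_minimizing hs hs_conv hs_closed hB hA hφ
    hφc hm hv (hu.congr fun n => (hvu n).symm)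
  exact ⟨v₀, hv₀, fun z hz => hval ▸ hm z hz⟩

/-- For an R-function, near-minimizers are close to minimizers. -/
theorem ReflexiveSpace.exists_near_minimizer [TopologicalSpace.SeparableSpace Z]
    (hZ : ReflexiveSpace Z) [TopologicalSpace Y] (hs : Bornology.IsBounded s)
    (hs_conv : Convex ℝ s) (hs_closed : IsClosed s) (hB : CompletelyContinuous B)
    {A : Y → ℝ} (hA : ContinuousOn A (B '' s)) {φ : Z → ℝ} (hφ : IsRFunction φ)
    {m : ℝ} (hm : ∀ z ∈ s, m ≤ A (B z) + φ z) {δ : ℝ} (hδ : 0 < δ) :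
    ∃ η > 0, ∀ z ∈ s, A (B z) + φ z ≤ m + η →
      ∃ z' ∈ s, A (B z') + φ z' = m ∧ ‖z - z'‖ < δ := by
  -- Failure for every `η = 1 / (n + 1)` would produce a minimizing sequence staying `δ`-away from
  -- all minimizers.
  by_contra! h
  choose v hv hvle hvfar using fun n : ℕ => h (1 / ((n : ℝ) + 1)) Nat.one_div_pos_of_nat
  have hvm : Tendsto (fun n => A (B (v n)) + φ (v n)) atTop (𝓝 m) := by
    refine tendsto_of_tendsto_of_tendsto_of_le_of_le tendsto_const_nhds ?_
      (fun n => hm _ (hv n)) hvle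
    simpa using tendsto_const_nhds.add (tendsto_one_div_add_atTop_nhds_zero_nat (𝕜 := ℝ))
  obtain ⟨v₀, k, hv₀, -, hval, hw, hφv⟩ := hZ.exists_subseq_of_minimizing hs hs_conv hs_closed hB
    hA hφ.convex hφ.continuous hm hv hvm
  have hnorm := hφ.tendsto_of_weak _ _ hw hφv
  obtain ⟨n, hn⟩ := ((tendsto_iff_norm_sub_tendsto_zero.1 hnorm).eventually
    (gt_mem_nhds hδ)).exists
  exact absurd hn (not_lt.2 (hvfar (k n) v₀ hv₀ hval))

end FunctionalAnalysis

/-! ### Optimal values and solution sets. -/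

section OptimalValue

variable {V : Type*} {J : V → ℝ} {A : Set V} {z : V}

theorem optVal_eq_of_isMin (hz : z ∈ A) (h : ∀ z' ∈ A, J z ≤ J z') : optVal J A = (J z : EReal) :=
  le_antisymm (iInf₂_le z hz) (le_iInf₂ fun z' hz' => EReal.coe_le_coe_iff.2 (h z' hz'))

theorem mem_solSet_iff : z ∈ solSet J A ↔ z ∈ A ∧ ∀ z' ∈ A, J z ≤ J z' := by
  refine ⟨fun h => ⟨h.1, fun z' hz' => EReal.coe_le_coe_iff.1 ?_⟩,
    fun h => ⟨h.1, (optVal_eq_of_isMin h.1 h.2).symm⟩⟩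
  rw [h.2]
  exact iInf₂_le z' hz'

theorem deviation_le {V : Type*} [NormedAddCommGroup V] {Γ Ψ : Set V} {δ : ℝ}
    (h : ∀ x ∈ Γ, ∃ y ∈ Ψ, ‖x - y‖ ≤ δ) : deviation Γ Ψ ≤ ENNReal.ofReal δ :=
  iSup₂_le fun x hx =>
    let ⟨y, hy, hxy⟩ := h x hx
    (iInf₂_le y hy).trans (ENNReal.ofReal_le_ofReal hxy)

end OptimalValue

/-! ### Nonatomic measures. -/

section Nonatomic

variable {Ω : Type*} [MeasurableSpace Ω] {P : Measure Ω} [IsFiniteMeasure P]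

/-- Of a set and its relative complement, one carries at most half of the mass; halving is iterated.
-/
theorem Nonatomic.exists_subset_lt (hP : Nonatomic P) {s : Set Ω} (hs : MeasurableSet s)
    (h0 : 0 < P.real s) {η : ℝ} (hη : 0 < η) :
    ∃ t ⊆ s, MeasurableSet t ∧ 0 < P.real t ∧ P.real t < η := by
  have half : ∀ r : Set Ω, MeasurableSet r → 0 < P.real r →
      ∃ t ⊆ r, MeasurableSet t ∧ 0 < P.real t ∧ P.real t ≤ P.real r / 2 := by
    intro r hr hr0
    obtain ⟨t, htr, ht, ht0, hlt⟩ := hP r hr (ENNReal.toReal_pos_iff.1 hr0).1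
    have h1 : 0 < P.real t := ENNReal.toReal_pos ht0.ne' (measure_ne_top _ _)
    have h2 : P.real t < P.real r := (ENNReal.toReal_lt_toReal (measure_ne_top _ _)
      (measure_ne_top _ _)).2 hlt
    have h3 := measureReal_sdiff (μ := P) htr ht
    rcases le_total (P.real t) (P.real r / 2) with h | h
    · exact ⟨t, htr, ht, h1, h⟩
    · exact ⟨r \ t, sdiff_subset, hr.diff ht, by linarith, by linarith⟩
  have iter : ∀ n : ℕ, ∃ t ⊆ s, MeasurableSet t ∧ 0 < P.real t ∧
      P.real t ≤ P.real s * (1 / 2) ^ n := by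
    intro n
    induction n with
    | zero => exact ⟨s, subset_rfl, hs, h0, by simp⟩
    | succ n ih =>
      obtain ⟨t, hts, ht, ht0, hle⟩ := ih
      obtain ⟨u, hut, hu, hu0, hule⟩ := half t ht ht0
      exact ⟨u, hut.trans hts, hu, hu0, by rw [pow_succ]; linarith⟩
  have hlim : Tendsto (fun n : ℕ => P.real s * (1 / 2 : ℝ) ^ n) atTop (𝓝 0) := by
    simpa using (tendsto_pow_atTop_nhds_zero_of_lt_one (r := (1 / 2 : ℝ)) (by norm_num)
      (by norm_num)).const_mul (P.real s)
  obtain ⟨n, hn⟩ := (hlim.eventually (gt_mem_nhds hη)).exists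
  obtain ⟨t, hts, ht, ht0, hle⟩ := iter n
  exact ⟨t, hts, ht, ht0, hle.trans_lt hn⟩

/-- **Sierpiński's theorem**: a nonatomic finite measure takes all intermediate values. -/
theorem Nonatomic.exists_subset_eq (hP : Nonatomic P) {s : Set Ω} (hs : MeasurableSet s)
    {a : ℝ} (ha0 : 0 ≤ a) (ha : a ≤ P.real s) :
    ∃ t ⊆ s, MeasurableSet t ∧ P.real t = a := by
  let C := {t : Set Ω // t ⊆ s ∧ MeasurableSet t ∧ P.real t ≤ a}
  -- Greedy exhaustion: stage `n` chooses an extension whose mass is within `1 / (n + 1)` of the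
  -- supremum over admissible extensions.
  have step : ∀ (n : ℕ) (A : C), ∃ A' : C, A.1 ⊆ A'.1 ∧
      ∀ D : C, A.1 ⊆ D.1 → P.real D.1 ≤ P.real A'.1 + 1 / ((n : ℝ) + 1) := by
    intro n A
    have hne : ((fun D : C => P.real D.1) '' {D | A.1 ⊆ D.1}).Nonempty :=
      ⟨_, A, subset_refl A.1, rfl⟩
    have hbdd : BddAbove ((fun D : C => P.real D.1) '' {D | A.1 ⊆ D.1}) :=
      ⟨a, by rintro _ ⟨D, -, rfl⟩; exact D.2.2.2⟩
    obtain ⟨_, ⟨A', hAA', rfl⟩, hlt⟩ := exists_lt_of_lt_csSup hne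
      (sub_lt_self _ (Nat.one_div_pos_of_nat (α := ℝ) (n := n)))
    refine ⟨A', hAA', fun D hD => ?_⟩
    have := le_csSup hbdd (mem_image_of_mem (fun D : C => P.real D.1) hD)
    simp only at this hlt ⊢
    linarith
  choose nxt hnxt_sub hnxt using step
  let A : ℕ → C := fun n => Nat.rec ⟨∅, empty_subset _, MeasurableSet.empty, by simpa⟩ nxt n
  have hA : ∀ n, A (n + 1) = nxt n (A n) := fun n => rfl
  have hmono : Monotone fun n => (A n).1 :=
    monotone_nat_of_le_succ fun n => by rw [hA]; exact hnxt_sub n (A n)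
  set U := ⋃ n, (A n).1 with hU
  have hUs : U ⊆ s := iUnion_subset fun n => (A n).2.1
  have hUm : MeasurableSet U := MeasurableSet.iUnion fun n => (A n).2.2.1
  have hUa : P.real U ≤ a := by
    have h := tendsto_measure_iUnion_atTop (μ := P) hmono
    have h' := (ENNReal.tendsto_toReal (measure_ne_top P U)).comp h
    exact le_of_tendsto' h' fun n => (A n).2.2.2
  refine ⟨U, hUs, hUm, hUa.antisymm ?_⟩
  by_contra! hlt
  have hdiff := measureReal_sdiff (μ := P) hUs hUm
  -- If `U` fell short of `a`, a small piece `E` could still be added at every stage, so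
  -- near-maximality gives `P E ≤ 1 / (n + 1)` for all `n`.
  obtain ⟨E, hEs, hE, hE0, hElt⟩ := hP.exists_subset_lt (hs.diff hUm) (by linarith)
    (sub_pos.2 hlt)
  have hUE : P.real (U ∪ E) = P.real U + P.real E :=
    measureReal_union (disjoint_sdiff_right.mono_right hEs) hE
  let D : C := ⟨U ∪ E, union_subset hUs (hEs.trans sdiff_subset), hUm.union hE, by linarith⟩
  have key : ∀ n : ℕ, P.real E ≤ 1 / ((n : ℝ) + 1) := by
    intro n
    have h1 := hnxt n (A n) D ((subset_iUnion (fun n => (A n).1) n).trans subset_union_left)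
    have h2 : P.real (A (n + 1)).1 ≤ P.real U :=
      measureReal_mono (subset_iUnion (fun n => (A n).1) (n + 1))
    rw [hA] at h2
    have h3 : P.real D.1 = P.real U + P.real E := hUE
    linarith
  exact absurd (ge_of_tendsto' (tendsto_one_div_add_atTop_nhds_zero_nat (𝕜 := ℝ)) key)
    (not_le.2 hE0)

theorem Nonatomic.exists_nat_valued (hP : Nonatomic P) {a : ℝ} (ha : 0 ≤ a) (n : ℕ)
    (hn : n * a ≤ P.real univ) :
    ∃ κ : Ω → ℕ, Measurable κ ∧ ∀ i < n, P.real (κ ⁻¹' {i}) = a := by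
  induction n with
  | zero => exact ⟨fun _ => 0, measurable_const, by simp⟩
  | succ n ih =>
    push_cast at hn
    obtain ⟨κ, hκ, h⟩ := ih (by linarith)
    have hlow : P.real (κ ⁻¹' Iio n) = n * a := by
      have h1 : κ ⁻¹' Iio n = ⋃ i ∈ Finset.range n, κ ⁻¹' {i} := by ext; simp
      rw [h1, measureReal_biUnion_finset
        (fun i _ j _ hij => (disjoint_singleton.2 hij).preimage κ)
        (fun i _ => hκ (measurableSet_singleton i)),
        Finset.sum_congr rfl fun i hi => h i (Finset.mem_range.1 hi)]
      simp
    have hIio : MeasurableSet (κ ⁻¹' Iio n) := hκ measurableSet_Iio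
    have hcompl := measureReal_compl (μ := P) hIio
    obtain ⟨t, htsub, ht, hta⟩ := hP.exists_subset_eq hIio.compl ha (by linarith)
    classical
    -- The value `n + 1` parks the remaining mass outside the fibers over `0, …, n`.
    refine ⟨fun ω => if ω ∈ t then n else if κ ω < n then κ ω else n + 1,
      Measurable.ite ht measurable_const (Measurable.ite hIio hκ measurable_const),
      fun i hi => ?_⟩
    rcases Nat.lt_succ_iff_lt_or_eq.1 hi with hi | rfl
    · rw [← h i hi]
      congr 1
      ext ω
      have := @htsub ω
      simp only [mem_preimage, mem_singleton_iff, mem_compl_iff, mem_Iio] at this ⊢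
      split_ifs <;> grind
    · rw [← hta]
      congr 1
      ext ω
      simp only [mem_preimage, mem_singleton_iff]
      split_ifs <;> grind

end Nonatomic

/-! ### Empirical distributions as laws under the uniform measure on indices. -/

section EmpiricalMeasure

/-- The uniform distribution on `{0, …, N - 1}`. -/
noncomputable def empMeasure (N : ℕ) : Measure ℕ :=
  (N : ℝ≥0∞)⁻¹ • ∑ i ∈ Finset.range N, Measure.dirac i

theorem isProbabilityMeasure_empMeasure {N : ℕ} (hN : 1 ≤ N) :
    IsProbabilityMeasure (empMeasure N) := by
  constructor
  simp only [empMeasure, Measure.smul_apply, Measure.finsetSum_apply, measure_univ,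
    Finset.sum_const, Finset.card_range, nsmul_eq_mul, mul_one, smul_eq_mul]
  exact ENNReal.inv_mul_cancel (by simpa using (by omega : N ≠ 0)) (ENNReal.natCast_ne_top N)

theorem integrable_empMeasure (N : ℕ) (x : ℕ → ℝ) : Integrable x (empMeasure N) := by
  rcases Nat.eq_zero_or_pos N with rfl | hN
  · simp [empMeasure]
  · refine Integrable.smul_measure ?_ (by simpa using hN.ne')
    exact integrable_finsetSum_measure.2 fun i _ => integrable_dirac (by simp)

theorem integral_empMeasure (N : ℕ) (x : ℕ → ℝ) :
    ∫ i, x i ∂(empMeasure N) = (∑ i ∈ Finset.range N, x i) / N := by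
  rw [empMeasure, integral_smul_measure, integral_finsetSum_measure
    fun i _ => integrable_dirac (by simp)]
  simp [div_eq_inv_mul]

theorem distFun_empMeasure (x : ℕ → ℝ) (N : ℕ) :
    distFun (empMeasure N) x = empDistFun x N := by
  ext t
  have h1 : distFun (empMeasure N) x t
      = ∫ i, (Iic t).indicator (fun _ => (1 : ℝ)) (x i) ∂(empMeasure N) := by
    have : (fun i => (Iic t).indicator (fun _ => (1 : ℝ)) (x i))
        = {i | x i ≤ t}.indicator fun _ => (1 : ℝ) := rfl
    rw [this, integral_indicator (by measurability)]
    simp [distFun]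
  rw [h1, integral_empMeasure, empDistFun, div_eq_inv_mul, one_div]

variable {Ω : Type*} [MeasurableSpace Ω] {P : Measure Ω} [IsProbabilityMeasure P]

theorem Nonatomic.exists_map_eq_empMeasure (hP : Nonatomic P) {N : ℕ} (hN : 1 ≤ N) :
    ∃ κ : Ω → ℕ, Measurable κ ∧ P.map κ = empMeasure N := by
  have hN0 : (N : ℝ) ≠ 0 := by positivity
  obtain ⟨κ, hκ, h⟩ := hP.exists_nat_valued (a := (N : ℝ)⁻¹) (by positivity) N
    (by simp [hN0])
  refine ⟨κ, hκ, ?_⟩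
  have := isProbabilityMeasure_empMeasure hN
  have := Measure.isProbabilityMeasure_map (μ := P) hκ.aemeasurable
  -- Between measures of equal finite mass, one inequality already gives equality.
  refine (Measure.eq_of_le_of_measure_univ_eq ?_ (by simp)).symm
  refine Measure.le_iff.2 fun s hs => ?_
  classical
  have h1 : empMeasure N s = ∑ i ∈ Finset.range N with i ∈ s, (N : ℝ≥0∞)⁻¹ := by
    simp only [empMeasure, Measure.smul_apply, Measure.finsetSum_apply, smul_eq_mul,
      Finset.mul_sum, Finset.sum_filter]
    refine Finset.sum_congr rfl fun i _ => ?_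
    by_cases hi : i ∈ s <;> simp [hi]
  have h2 : ∀ i ∈ (Finset.range N).filter (· ∈ s), (N : ℝ≥0∞)⁻¹ = P.map κ {i} := by
    intro i hi
    have hi' := h i (Finset.mem_range.1 (Finset.mem_filter.1 hi).1)
    rw [Measure.map_apply hκ (measurableSet_singleton i),
      ← ENNReal.ofReal_toReal (measure_ne_top P (κ ⁻¹' {i}))]
    change _ = ENNReal.ofReal (P.real _)
    rw [hi', ENNReal.ofReal_inv_of_pos (by positivity), ENNReal.ofReal_natCast]
  rw [h1, Finset.sum_congr rfl h2, sum_measure_singleton]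
  exact measure_mono fun i hi => (Finset.mem_filter.1 hi).2

/-- The value of the smoothed average value-at-risk at an empirical distribution function. -/
theorem riskAt_smoothedAvar_empDistFun (hP : Nonatomic P) {N : ℕ} (hN : 1 ≤ N) (p : ℝ≥0∞)
    (β ε : ℝ) (x : ℕ → ℝ) :
    riskAt P p (smoothedAvar P β ε) (empDistFun x N) = smoothedAvar (empMeasure N) β ε x := by
  obtain ⟨κ, hκ, hmap⟩ := hP.exists_map_eq_empMeasure hN
  -- Almost surely `κ` takes only values below `N`, so `x ∘ κ` is essentially bounded and lies in
  -- every `L^p`.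
  have hbound : ∀ᵐ ω ∂P, ‖x (κ ω)‖ ≤ ∑ i ∈ Finset.range N, ‖x i‖ := by
    refine ae_of_ae_map (p := fun i => ‖x i‖ ≤ _) hκ.aemeasurable ?_
    rw [hmap]
    refine Measure.ae_smul_measure ?_ _
    refine (ae_finsetSum_measure_iff).2 fun i hi => ?_
    rw [ae_dirac_eq]
    exact Finset.single_le_sum (f := fun i => ‖x i‖) (fun _ _ => norm_nonneg _) hi
  have hmem : MemLp (fun ω => x (κ ω)) p P :=
    MemLp.of_bound ((measurable_of_countable x).comp hκ).aestronglyMeasurable _ hbound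
  have hdist : empDistFun x N = distFun P fun ω => x (κ ω) := by
    rw [← distFun_empMeasure, ← hmap]
    ext t
    exact map_measureReal_apply hκ (by measurability)
  rw [hdist, riskAt_distFun (lawInvariant_smoothedAvar P p β ε) hmem]
  unfold smoothedAvar
  congr 1
  funext t
  rw [← hmap, integral_map hκ.aemeasurable (measurable_of_countable _).aestronglyMeasurable]

end EmpiricalMeasure

/-! ### A common framework for AVaR and its smoothing. -/

section OptimizedCertaintyEquivalent

variable {α : Type*} [MeasurableSpace α]

/-- The functional `X ↦ inf_t {t + c E[φ(X - t)]}`. -/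
noncomputable def oce (μ : Measure α) (c : ℝ) (φ : ℝ → ℝ) (X : α → ℝ) : ℝ :=
  ⨅ t : ℝ, (t + c * ∫ a, φ (X a - t) ∂μ)

variable {μ : Measure α} [IsProbabilityMeasure μ] {c : ℝ} {φ : ℝ → ℝ} {X X' : α → ℝ}

theorem integrable_comp_sub (hφ : LipschitzWith 1 φ) (hX : Integrable X μ) (t : ℝ) :
    Integrable (fun a => φ (X a - t)) μ := by
  have hb : Integrable (fun a => |φ 0| + |X a - t|) μ :=
    (integrable_const _).add (hX.sub (integrable_const t)).abs
  refine hb.mono' (hφ.continuous.comp_aestronglyMeasurable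
    (hX.aestronglyMeasurable.sub aestronglyMeasurable_const)) (Eventually.of_forall fun a => ?_)
  have h := hφ.dist_le_mul (X a - t) 0
  simp only [NNReal.coe_one, one_mul, Real.dist_eq, sub_zero] at h
  rw [Real.norm_eq_abs]
  have := abs_add_le (φ 0) (φ (X a - t) - φ 0)
  rw [add_sub_cancel] at this
  linarith

/-- Since `φ ≥ 0` and `c ≥ 1`, the factor `c` may be dropped, and then `φ x ≥ x` is used. This keeps
the real infimum in `oce` from taking its default value. -/
theorem integral_le_oce_term (hc : 1 ≤ c) (hφ : LipschitzWith 1 φ) (hφ0 : ∀ x, max 0 x ≤ φ x)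
    (hX : Integrable X μ) (t : ℝ) : ∫ a, X a ∂μ ≤ t + c * ∫ a, φ (X a - t) ∂μ := by
  have hint := integrable_comp_sub hφ hX t
  have h0 : 0 ≤ ∫ a, φ (X a - t) ∂μ :=
    integral_nonneg fun a => (le_max_left _ _).trans (hφ0 _)
  have h1 : ∫ a, (X a - t) ∂μ ≤ ∫ a, φ (X a - t) ∂μ :=
    integral_mono (hX.sub (integrable_const t)) hint
      fun a => (le_max_right _ _).trans (hφ0 _)
  rw [integral_sub hX (integrable_const t)] at h1
  simp only [integral_const, probReal_univ, one_smul] at h1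
  nlinarith

theorem bddBelow_oce (hc : 1 ≤ c) (hφ : LipschitzWith 1 φ) (hφ0 : ∀ x, max 0 x ≤ φ x)
    (hX : Integrable X μ) : BddBelow (range fun t : ℝ => t + c * ∫ a, φ (X a - t) ∂μ) :=
  ⟨∫ a, X a ∂μ, by rintro _ ⟨t, rfl⟩; exact integral_le_oce_term hc hφ hφ0 hX t⟩

theorem oce_le (hc : 1 ≤ c) (hφ : LipschitzWith 1 φ) (hφ0 : ∀ x, max 0 x ≤ φ x)
    (hX : Integrable X μ) (t : ℝ) : oce μ c φ X ≤ t + c * ∫ a, φ (X a - t) ∂μ :=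
  ciInf_le (bddBelow_oce hc hφ hφ0 hX) t

theorem oce_le_oce_add (hc : 1 ≤ c) (hφ : LipschitzWith 1 φ) (hφ0 : ∀ x, max 0 x ≤ φ x)
    (hX : Integrable X μ) (hX' : Integrable X' μ) :
    oce μ c φ X ≤ oce μ c φ X' + c * ∫ a, |X a - X' a| ∂μ := by
  rw [← sub_le_iff_le_add]
  refine le_ciInf fun t => ?_
  rw [sub_le_iff_le_add]
  refine (oce_le hc hφ hφ0 hX t).trans ?_
  have hd : Integrable (fun a => |X a - X' a|) μ := (hX.sub hX').abs
  have hint := integrable_comp_sub hφ hX' t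
  rw [add_assoc, ← mul_add, ← integral_add hint hd]
  have h1 : ∫ a, φ (X a - t) ∂μ ≤ ∫ a, (φ (X' a - t) + |X a - X' a|) ∂μ := by
    refine integral_mono (integrable_comp_sub hφ hX t) (hint.add hd) fun a => ?_
    have h := hφ.dist_le_mul (X a - t) (X' a - t)
    simp only [NNReal.coe_one, one_mul, Real.dist_eq, sub_sub_sub_cancel_right] at h
    linarith [(abs_le.1 h).2]
  gcongr

theorem abs_oce_sub_oce_le (hc : 1 ≤ c) (hφ : LipschitzWith 1 φ) (hφ0 : ∀ x, max 0 x ≤ φ x)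
    (hX : Integrable X μ) (hX' : Integrable X' μ) :
    |oce μ c φ X - oce μ c φ X'| ≤ c * ∫ a, |X a - X' a| ∂μ := by
  have h1 := oce_le_oce_add hc hφ hφ0 hX hX'
  have h2 := oce_le_oce_add hc hφ hφ0 hX' hX
  simp_rw [abs_sub_comm (X' _)] at h2
  exact abs_le.2 ⟨by linarith, by linarith⟩

theorem oce_mono (hc : 1 ≤ c) (hφ : LipschitzWith 1 φ) (hφ0 : ∀ x, max 0 x ≤ φ x)
    (hmono : Monotone φ) (hX : Integrable X μ) (hX' : Integrable X' μ) (h : ∀ a, X a ≤ X' a) :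
    oce μ c φ X ≤ oce μ c φ X' := by
  refine ciInf_mono (bddBelow_oce hc hφ hφ0 hX) fun t => ?_
  have h1 : ∫ a, φ (X a - t) ∂μ ≤ ∫ a, φ (X' a - t) ∂μ :=
    integral_mono (integrable_comp_sub hφ hX t) (integrable_comp_sub hφ hX' t)
      fun a => hmono (sub_le_sub_right (h a) t)
  gcongr

/-- Gives both halves of the smoothing estimate: `d = 0` one way, `d = ε * log 2` the other. -/
theorem oce_le_oce_add_of_le {ψ : ℝ → ℝ} (hc : 1 ≤ c) (hφ : LipschitzWith 1 φ)
    (hφ0 : ∀ x, max 0 x ≤ φ x) (hψ : LipschitzWith 1 ψ) {d : ℝ} (h : ∀ x, φ x ≤ ψ x + d)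
    (hX : Integrable X μ) : oce μ c φ X ≤ oce μ c ψ X + c * d := by
  rw [← sub_le_iff_le_add]
  refine le_ciInf fun t => ?_
  rw [sub_le_iff_le_add]
  refine (oce_le hc hφ hφ0 hX t).trans ?_
  have h1 : ∫ a, φ (X a - t) ∂μ ≤ ∫ a, (ψ (X a - t) + d) ∂μ :=
    integral_mono (integrable_comp_sub hφ hX t)
      ((integrable_comp_sub hψ hX t).add (integrable_const d)) fun a => h _
  rw [integral_add (integrable_comp_sub hψ hX t) (integrable_const d)] at h1
  simp only [integral_const, probReal_univ, one_smul] at h1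
  nlinarith

end OptimizedCertaintyEquivalent

/-! ### The plus function and its log-exp smoothing. -/

section PlusFunctions

theorem lipschitzWith_max_zero : LipschitzWith 1 (max (0 : ℝ)) :=
  LipschitzWith.id.const_max 0

theorem monotone_max_zero : Monotone (max (0 : ℝ)) := fun _ _ h => max_le_max le_rfl h

variable {ε : ℝ}

theorem max_zero_le_smoothedPlus (hε : 0 < ε) (x : ℝ) : max 0 x ≤ smoothedPlus ε x := by
  refine max_le ?_ ?_
  · exact mul_nonneg hε.le (Real.log_nonneg (by linarith [Real.exp_pos (x / ε)]))
  · have h : x / ε ≤ Real.log (1 + Real.exp (x / ε)) := by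
      rw [Real.le_log_iff_exp_le (by positivity)]
      linarith
    rw [div_le_iff₀ hε] at h
    rw [smoothedPlus]
    linarith

/-- Rests on `1 + exp (x / ε) ≤ 2 * exp (max 0 x / ε)`. -/
theorem smoothedPlus_le (hε : 0 < ε) (x : ℝ) : smoothedPlus ε x ≤ max 0 x + ε * Real.log 2 := by
  have h : Real.log (1 + Real.exp (x / ε)) ≤ max 0 x / ε + Real.log 2 := by
    rw [Real.log_le_iff_le_exp (by positivity), Real.exp_add, Real.exp_log two_pos]
    have h1 : Real.exp (x / ε) ≤ Real.exp (max 0 x / ε) := by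
      gcongr
      exact le_max_right _ _
    have h2 : 1 ≤ Real.exp (max 0 x / ε) := Real.one_le_exp (by positivity)
    linarith
  calc ε * Real.log (1 + Real.exp (x / ε)) ≤ ε * (max 0 x / ε + Real.log 2) := by gcongr
    _ = max 0 x + ε * Real.log 2 := by field_simp

/-- Rests on `1 + exp (x / ε) ≤ (1 + exp (y / ε)) * exp (|x - y| / ε)`. -/
theorem lipschitzWith_smoothedPlus (hε : 0 < ε) : LipschitzWith 1 (smoothedPlus ε) := by
  refine LipschitzWith.of_le_add fun x y => ?_
  have h : Real.log (1 + Real.exp (x / ε))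
      ≤ Real.log (1 + Real.exp (y / ε)) + |x - y| / ε := by
    rw [Real.log_le_iff_le_exp (by positivity), Real.exp_add, Real.exp_log (by positivity),
      add_mul, one_mul, ← Real.exp_add, ← add_div]
    have h1 : 1 ≤ Real.exp (|x - y| / ε) := Real.one_le_exp (by positivity)
    have h2 : Real.exp (x / ε) ≤ Real.exp ((y + |x - y|) / ε) := by
      gcongr
      linarith [le_abs_self (x - y)]
    linarith
  calc ε * Real.log (1 + Real.exp (x / ε))
      ≤ ε * (Real.log (1 + Real.exp (y / ε)) + |x - y| / ε) := by gcongr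
    _ = smoothedPlus ε y + dist x y := by rw [smoothedPlus, Real.dist_eq]; field_simp

variable {α : Type*} [MeasurableSpace α] {μ : Measure α} [IsProbabilityMeasure μ] {β : ℝ}
  {X X' : α → ℝ}

theorem one_le_one_div_one_sub (hβ : β ∈ Ico (0 : ℝ) 1) : 1 ≤ 1 / (1 - β) := by
  rw [le_div_iff₀ (by linarith [hβ.2])]
  linarith [hβ.1]

theorem abs_avar_sub_avar_le (hβ : β ∈ Ico (0 : ℝ) 1) (hX : Integrable X μ)
    (hX' : Integrable X' μ) :
    |avar μ β X - avar μ β X'| ≤ 1 / (1 - β) * ∫ a, |X a - X' a| ∂μ :=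
  abs_oce_sub_oce_le (one_le_one_div_one_sub hβ) lipschitzWith_max_zero (fun _ => le_rfl) hX hX'

theorem avar_mono (hβ : β ∈ Ico (0 : ℝ) 1) (hX : Integrable X μ) (hX' : Integrable X' μ)
    (h : ∀ a, X a ≤ X' a) : avar μ β X ≤ avar μ β X' :=
  oce_mono (one_le_one_div_one_sub hβ) lipschitzWith_max_zero (fun _ => le_rfl)
    monotone_max_zero hX hX' h

theorem abs_smoothedAvar_sub_smoothedAvar_le (hβ : β ∈ Ico (0 : ℝ) 1) (hε : 0 < ε)
    (hX : Integrable X μ) (hX' : Integrable X' μ) :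
    |smoothedAvar μ β ε X - smoothedAvar μ β ε X'| ≤ 1 / (1 - β) * ∫ a, |X a - X' a| ∂μ :=
  abs_oce_sub_oce_le (one_le_one_div_one_sub hβ) (lipschitzWith_smoothedPlus hε)
    (max_zero_le_smoothedPlus hε) hX hX'

theorem avar_le_smoothedAvar (hβ : β ∈ Ico (0 : ℝ) 1) (hε : 0 < ε) (hX : Integrable X μ) :
    avar μ β X ≤ smoothedAvar μ β ε X := by
  have := oce_le_oce_add_of_le (d := 0) (one_le_one_div_one_sub hβ) lipschitzWith_max_zero
    (fun _ => le_rfl) (lipschitzWith_smoothedPlus hε)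
    (fun x => by simpa using max_zero_le_smoothedPlus hε x) hX
  rwa [mul_zero, add_zero] at this

theorem smoothedAvar_le_avar_add (hβ : β ∈ Ico (0 : ℝ) 1) (hε : 0 < ε) (hX : Integrable X μ) :
    smoothedAvar μ β ε X ≤ avar μ β X + 1 / (1 - β) * (ε * Real.log 2) :=
  oce_le_oce_add_of_le (one_le_one_div_one_sub hβ) (lipschitzWith_smoothedPlus hε)
    (max_zero_le_smoothedPlus hε) lipschitzWith_max_zero (smoothedPlus_le hε) hX

end PlusFunctions

/-! ### Strong law of large numbers for AVaR. -/

section LawOfLargeNumbers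

theorem tendsto_integral_max_neg_sub {α : Type*} [MeasurableSpace α] {μ : Measure α} {X : α → ℝ}
    (hX : Integrable X μ) :
    Tendsto (fun M : ℕ => ∫ a, max 0 (-(M : ℝ) - X a) ∂μ) atTop (𝓝 0) := by
  have h : Tendsto (fun M : ℕ => ∫ a, max 0 (-(M : ℝ) - X a) ∂μ) atTop (𝓝 (∫ _, (0 : ℝ) ∂μ)) := by
    refine tendsto_integral_of_dominated_convergence (fun a => |X a|) (fun M => ?_) hX.abs
      (fun M => Eventually.of_forall fun a => ?_) (Eventually.of_forall fun a => ?_)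
    · exact lipschitzWith_max_zero.continuous.comp_aestronglyMeasurable
        (aestronglyMeasurable_const.sub hX.aestronglyMeasurable)
    · rw [Real.norm_eq_abs, abs_of_nonneg (le_max_left _ _)]
      refine max_le (abs_nonneg _) ?_
      have := neg_le_abs (X a)
      have : (0 : ℝ) ≤ M := M.cast_nonneg
      linarith
    · refine tendsto_const_nhds.congr' ?_
      filter_upwards [tendsto_natCast_atTop_atTop.eventually (eventually_ge_atTop (-X a))]
        with M hM
      rw [max_eq_left (by linarith)]
  simpa using h

theorem ae_forall_sample {Ω Ξ : Type*} [MeasurableSpace Ω] {P : Measure Ω} [MeasurableSpace Ξ]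
    {ξ : Ω → Ξ} {ξs : ℕ → Ω → Ξ} (hξs : ∀ i, Measurable (ξs i))
    (hlaw : ∀ i, P.map (ξs i) = P.map ξ) {q : Ξ → Prop} (hq : ∀ᵐ x ∂(P.map ξ), q x) : ∀ᵐ ω ∂P, ∀ i, q (ξs i ω) :=
  ae_all_iff.2 fun i => ae_of_ae_map (hξs i).aemeasurable (by rwa [hlaw i])

/-- The strong law of large numbers for integrands that are measurable with respect to the
completion of the law. -/
theorem ae_tendsto_integral_empMeasure {Ω Ξ : Type*} [MeasurableSpace Ω] {P : Measure Ω}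
    [MeasurableSpace Ξ] {ξ : Ω → Ξ} {ξs : ℕ → Ω → Ξ} (hξ : Measurable ξ)
    (hξs : ∀ i, Measurable (ξs i)) (hindep : iIndepFun ξs P) (hlaw : ∀ i, P.map (ξs i) = P.map ξ) {g : Ξ → ℝ}
    (hg : Integrable g (P.map ξ)) :
    ∀ᵐ ω ∂P, Tendsto (fun n => ∫ i, g (ξs i ω) ∂(empMeasure n)) atTop
      (𝓝 (∫ ω, g (ξ ω) ∂P)) := by
  -- The strong law is applied to a measurable version; almost surely it agrees with `g` at all
  -- samples at once.
  set g' := hg.aestronglyMeasurable.mk g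
  have hg' : StronglyMeasurable g' := hg.aestronglyMeasurable.stronglyMeasurable_mk
  have heq : g =ᵐ[P.map ξ] g' := hg.aestronglyMeasurable.ae_eq_mk
  have hint : Integrable g' (P.map ξ) := hg.congr heq
  have hslln := strong_law_ae_real (μ := P) (fun i ω => g' (ξs i ω))
    (by
      have h1 : Integrable g' (P.map (ξs 0)) := by rwa [hlaw 0]
      exact h1.comp_measurable (hξs 0))
    (fun i j hij => (hindep.indepFun hij).comp hg'.measurable hg'.measurable)
    (fun i => IdentDistrib.comp ⟨(hξs i).aemeasurable, (hξs 0).aemeasurable,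
      (hlaw i).trans (hlaw 0).symm⟩ hg'.measurable)
  have hval : ∫ ω, g' (ξs 0 ω) ∂P = ∫ ω, g (ξ ω) ∂P := by
    rw [← integral_map (hξs 0).aemeasurable hg'.aestronglyMeasurable, hlaw 0,
      ← integral_congr_ae heq, integral_map hξ.aemeasurable hg.aestronglyMeasurable]
  filter_upwards [hslln, ae_forall_sample hξs hlaw heq] with ω h1 h2
  simp_rw [integral_empMeasure, h2]
  rwa [hval] at h1

section Terms

variable {α : Type*} [MeasurableSpace α] {μ : Measure α} [IsProbabilityMeasure μ] {c : ℝ}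
  {X : α → ℝ}

theorem add_integral_max_sub_le (hc : 0 ≤ c) (hX : Integrable X μ) {s t : ℝ} (hst : s ≤ t) :
    t + c * ∫ a, max 0 (X a - t) ∂μ - (t - s) ≤ s + c * ∫ a, max 0 (X a - s) ∂μ := by
  have h : ∫ a, max 0 (X a - t) ∂μ ≤ ∫ a, max 0 (X a - s) ∂μ :=
    integral_mono (integrable_comp_sub lipschitzWith_max_zero hX t)
      (integrable_comp_sub lipschitzWith_max_zero hX s)
      fun a => max_le_max le_rfl (sub_le_sub_left hst _)
  nlinarith

theorem integral_max_sub_swap (hX : Integrable X μ) (s : ℝ) :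
    ∫ a, max 0 (s - X a) ∂μ = ∫ a, max 0 (X a - s) ∂μ - ∫ a, X a ∂μ + s := by
  have h : ∀ a, max 0 (s - X a) = max 0 (X a - s) - X a + s := fun a => by
    rcases le_total s (X a) with h | h
    · rw [max_eq_left (by linarith), max_eq_right (by linarith)]; ring
    · rw [max_eq_right (by linarith), max_eq_left (by linarith)]; ring
  have hi := integrable_comp_sub lipschitzWith_max_zero hX s
  have hi' : Integrable (fun a => max 0 (X a - s) - X a) μ := hi.sub hX
  simp_rw [h]
  rw [integral_add hi' (integrable_const s), integral_sub hi hX]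
  simp

/-- Both sides are compared with `r ↦ c * E[X] - (c - 1) * r`, nonincreasing as `c ≥ 1`: the left
side is its value at `s`, the right side dominates its value at `t`. It controls `t` far to the
left. -/
theorem add_integral_max_sub_le' (hc : 1 ≤ c) (hX : Integrable X μ) {s t : ℝ} (hts : t ≤ s) :
    s + c * ∫ a, max 0 (X a - s) ∂μ - c * ∫ a, max 0 (s - X a) ∂μ
      ≤ t + c * ∫ a, max 0 (X a - t) ∂μ := by
  have h1 : ∫ a, (X a - t) ∂μ ≤ ∫ a, max 0 (X a - t) ∂μ :=
    integral_mono (hX.sub (integrable_const t))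
      (integrable_comp_sub lipschitzWith_max_zero hX t) fun a => le_max_right _ _
  rw [integral_sub hX (integrable_const t)] at h1
  simp only [integral_const, probReal_univ, one_smul] at h1
  rw [integral_max_sub_swap hX]
  nlinarith

end Terms

variable {Ω : Type*} [MeasurableSpace Ω] {P : Measure Ω} [IsProbabilityMeasure P] {β : ℝ}
  {X : Ω → ℝ}

/-- A deterministic statement, so countably many limits suffice. The infimum over `t` is reduced to
a finite rational grid on `[-M, M]`, with the two tails treated separately. -/
theorem tendsto_avar_empMeasure (hβ : β ∈ Ico (0 : ℝ) 1) (hX : Integrable X P) {x : ℕ → ℝ}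
    (h0 : Tendsto (fun n => ∫ i, x i ∂(empMeasure n)) atTop (𝓝 (∫ ω, X ω ∂P)))
    (hq : ∀ q : ℚ, Tendsto (fun n => ∫ i, max 0 (x i - q) ∂(empMeasure n)) atTop
      (𝓝 (∫ ω, max 0 (X ω - q) ∂P))) :
    Tendsto (fun n => avar (empMeasure n) β x) atTop (𝓝 (avar P β X)) := by
  have hc := one_le_one_div_one_sub hβ
  have hmax : ∀ y : ℝ, max 0 y ≤ max 0 y := fun y => le_rfl
  set c := 1 / (1 - β)
  have hc0 : 0 ≤ c := zero_le_one.trans hc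
  have hG : ∀ q : ℚ, Tendsto (fun n => (q : ℝ) + c * ∫ i, max 0 (x i - q) ∂(empMeasure n)) atTop
      (𝓝 (q + c * ∫ ω, max 0 (X ω - q) ∂P)) := fun q => ((hq q).const_mul c).const_add _
  have ha : ∀ t : ℝ, avar P β X ≤ t + c * ∫ ω, max 0 (X ω - t) ∂P :=
    oce_le hc lipschitzWith_max_zero hmax hX
  set a := avar P β X
  rw [Metric.tendsto_nhds]
  intro η' hη'
  set η := η' / 5 with hη_def
  have hη : 0 < η := by positivity
  -- the upper bound
  have hupper : ∀ᶠ n in atTop, avar (empMeasure n) β x < a + 2 * η := by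
    obtain ⟨t, ht⟩ := exists_lt_of_ciInf_lt (lt_add_of_pos_right a hη)
    change t + c * _ < _ at ht
    obtain ⟨q, htq, hqt⟩ := exists_rat_btwn (lt_add_of_pos_right t hη)
    have h1 := add_integral_max_sub_le hc0 hX htq.le
    have h2 : (q : ℝ) + c * ∫ ω, max 0 (X ω - q) ∂P < a + 2 * η := by linarith
    filter_upwards [(hG q).eventually (gt_mem_nhds h2),
      eventually_ge_atTop 1] with n hn hn1
    have := isProbabilityMeasure_empMeasure hn1
    exact (oce_le hc lipschitzWith_max_zero hmax (integrable_empMeasure n x) q).trans_lt hn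
  -- the lower bound
  obtain ⟨m, hm⟩ := exists_nat_one_div_lt hη
  -- For `t ≥ M` the term is at least `t ≥ a`; for `t ≤ -M` it is compared with the term at `-M`, at
  -- the cost of this lower-tail integral.
  obtain ⟨M, hMa, hM⟩ : ∃ M : ℕ, a ≤ M ∧ c * ∫ ω, max 0 (-(M : ℝ) - X ω) ∂P < η := by
    have h1 := (tendsto_integral_max_neg_sub hX).const_mul c
    rw [mul_zero] at h1
    exact ((tendsto_natCast_atTop_atTop.eventually (eventually_ge_atTop a)).and
      (h1.eventually (gt_mem_nhds hη))).exists
  have htail : ∀ᶠ n in atTop, c * ∫ i, max 0 (-(M : ℝ) - x i) ∂(empMeasure n) < η := by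
    have h1 : Tendsto (fun n => c * (∫ i, max 0 (x i - -(M : ℝ)) ∂(empMeasure n)
        - ∫ i, x i ∂(empMeasure n) + -(M : ℝ))) atTop
        (𝓝 (c * ∫ ω, max 0 (-(M : ℝ) - X ω) ∂P)) := by
      rw [integral_max_sub_swap hX]
      have := hq (-(M : ℚ))
      push_cast at this
      exact ((this.sub h0).add_const _).const_mul c
    filter_upwards [h1.eventually (gt_mem_nhds hM), eventually_ge_atTop 1] with n hn hn1
    have := isProbabilityMeasure_empMeasure hn1
    rwa [integral_max_sub_swap (integrable_empMeasure n x)]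
  have hgrid : ∀ᶠ n in atTop, ∀ k ∈ Finset.Icc (-(M * (m + 1) : ℤ)) (M * (m + 1)),
      a - η < (k / (m + 1) : ℝ) + c * ∫ i, max 0 (x i - k / (m + 1)) ∂(empMeasure n) := by
    rw [Finset.eventually_all]
    intro k _
    have h1 := hG (k / (m + 1))
    push_cast at h1
    exact h1.eventually (lt_mem_nhds ((sub_lt_self a hη).trans_le (ha _)))
  filter_upwards [hupper, htail, hgrid, eventually_ge_atTop 1] with n hn1 hn2 hn3 hn
  have := isProbabilityMeasure_empMeasure hn
  have hx := integrable_empMeasure n x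
  have hm0 : (0 : ℝ) < m + 1 := by positivity
  have hlower : a - 3 * η ≤ avar (empMeasure n) β x := by
    refine le_ciInf fun t => ?_
    have hpos : 0 ≤ ∫ i, max 0 (x i - t) ∂(empMeasure n) :=
      integral_nonneg fun i => le_max_left _ _
    rcases le_total (M : ℝ) t with hMt | htM
    · nlinarith
    rcases le_total t (-(M : ℝ)) with htM' | hMt
    · have h1 := add_integral_max_sub_le' hc hx htM'
      have h2 := hn3 (-(M * (m + 1))) (by rw [Finset.mem_Icc]; constructor <;> nlinarith)
      have h3 : ((-(M * (m + 1) : ℤ) : ℤ) : ℝ) / (m + 1) = -(M : ℝ) := by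
        push_cast; field_simp
      rw [h3] at h2
      linarith
    -- The next grid point to the right is less than `η` away, and moving right lowers the term by
    -- no more than the distance moved.
    · set k := ⌈t * (m + 1)⌉ with hk
      have hk1 : t * (m + 1) ≤ k := Int.le_ceil _
      have hk2 : (k : ℝ) < t * (m + 1) + 1 := Int.ceil_lt_add_one _
      have hkmem : k ∈ Finset.Icc (-(M * (m + 1) : ℤ)) (M * (m + 1)) := by
        rw [Finset.mem_Icc]
        constructor
        · have : ((-(M * (m + 1) : ℤ) : ℤ) : ℝ) ≤ k := by push_cast; nlinarith
          exact_mod_cast this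
        · rw [hk, Int.ceil_le]; push_cast; nlinarith
      have h1 : t ≤ k / (m + 1) := by rwa [le_div_iff₀ hm0]
      have h2 : (k : ℝ) / (m + 1) ≤ t + 1 / (m + 1) := by
        rw [div_le_iff₀ hm0, add_mul, one_div_mul_cancel hm0.ne']; exact hk2.le
      have h3 := add_integral_max_sub_le hc0 hx h1
      have h4 := hn3 k hkmem
      linarith
  rw [Real.dist_eq, abs_lt]
  constructor <;> linarith

variable {Ξ : Type*} [MeasurableSpace Ξ] {ξ : Ω → Ξ} {ξs : ℕ → Ω → Ξ}

variable {Ξ : Type*} [MeasurableSpace Ξ] {ξ : Ω → Ξ} {ξs : ℕ → Ω → Ξ}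

theorem ae_tendsto_avar_empMeasure (hβ : β ∈ Ico (0 : ℝ) 1) (hξ : Measurable ξ)
    (hξs : ∀ i, Measurable (ξs i)) (hindep : iIndepFun ξs P)
    (hlaw : ∀ i, P.map (ξs i) = P.map ξ) {g : Ξ → ℝ} (hg : Integrable g (P.map ξ)) :
    ∀ᵐ ω ∂P, Tendsto (fun n => avar (empMeasure n) β fun i => g (ξs i ω)) atTop
      (𝓝 (avar P β fun ω => g (ξ ω))) := by
  have := Measure.isProbabilityMeasure_map (μ := P) hξ.aemeasurable
  have h1 := ae_tendsto_integral_empMeasure hξ hξs hindep hlaw hg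
  have h2 := ae_all_iff.2 fun q : ℚ => ae_tendsto_integral_empMeasure hξ hξs hindep hlaw
    (integrable_comp_sub lipschitzWith_max_zero hg q)
  filter_upwards [h1, h2] with ω h1 h2
  exact tendsto_avar_empMeasure hβ (hg.comp_measurable hξ) h1 h2

end LawOfLargeNumbers

/-! ### Uniform lower bounds on compact sets. -/

section EpigraphicalLaw

variable {Ω Ξ Y : Type*} [MeasurableSpace Ω] {P : Measure Ω} [IsProbabilityMeasure P]
  [MeasurableSpace Ξ] {ξ : Ω → Ξ} [MetricSpace Y] {K : Set Y} {f : Y → Ξ → ℝ} {β : ℝ}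

/-- Near each point of a compact set there is an integrable lower envelope of a Carathéodory
integrand whose average value-at-risk is nearly that of the integrand at this point. -/
theorem exists_lower_envelope (hβ : β ∈ Ico (0 : ℝ) 1) (hξ : Measurable ξ) (hK : IsCompact K)
    (hf_meas : ∀ y ∈ K, NullMeasurable (f y) (P.map ξ))
    (hf_cont : ∀ x, ContinuousOn (fun y => f y x) K)
    (hint : ∀ y ∈ K, Integrable (fun ω => f y (ξ ω)) P) {y₀ : Y} (hy₀ : y₀ ∈ K)
    (hlow : ∃ V ∈ 𝓝 y₀, ∃ h : Ω → ℝ, Integrable h P ∧ ∀ y ∈ V ∩ K, ∀ᵐ ω ∂P, h ω ≤ f y (ξ ω))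
    {η : ℝ} (hη : 0 < η) :
    ∃ U ∈ 𝓝 y₀, ∃ g : Ξ → ℝ, Integrable g (P.map ξ) ∧ (∀ y ∈ U ∩ K, ∀ x, g x ≤ f y x) ∧
      (avar P β fun ω => f y₀ (ξ ω)) - η ≤ avar P β fun ω => g (ξ ω) := by
  obtain ⟨V, hV, h, hh, hhV⟩ := hlow
  obtain ⟨n₀, hn₀⟩ : ∃ n₀ : ℕ, Metric.ball y₀ (1 / ((n₀ : ℝ) + 1)) ⊆ V := by
    obtain ⟨r, hr, hrV⟩ := Metric.mem_nhds_iff.1 hV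
    obtain ⟨n, hn⟩ := exists_nat_one_div_lt hr
    exact ⟨n, (Metric.ball_subset_ball hn.le).trans hrV⟩
  let T : ℕ → Set Y := fun n => K ∩ Metric.ball y₀ (1 / (((n + n₀ : ℕ) : ℝ) + 1))
  have hTV : ∀ n, T n ⊆ V ∩ K := fun n y hy => ⟨hn₀ (Metric.ball_subset_ball
    (Nat.one_div_le_one_div (Nat.le_add_left n₀ n)) hy.2), hy.1⟩
  have hy₀T : ∀ n, y₀ ∈ T n := fun n => ⟨hy₀, Metric.mem_ball_self Nat.one_div_pos_of_nat⟩
  have hTne : ∀ n, Nonempty (T n) := fun n => ⟨⟨y₀, hy₀T n⟩⟩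
  have hTsep : ∀ n, TopologicalSpace.SeparableSpace (T n) := fun n =>
    (hK.isSeparable.mono inter_subset_left).separableSpace
  let d : ∀ n, ℕ → T n := fun n => TopologicalSpace.denseSeq (T n)
  -- A countable infimum stays measurable; continuity in `y` extends its lower bound to all of `T
  -- n`. Compactness of `K` makes it finite for every `x`.
  let g : ℕ → Ξ → ℝ := fun n x => ⨅ i, f (d n i) x
  have hgle : ∀ n, ∀ y ∈ T n, ∀ x, g n x ≤ f y x := by
    intro n y hy x
    have hbdd : BddBelow (range fun i => f (d n i) x) :=
      (hK.image_of_continuousOn (hf_cont x)).bddBelow.mono <| by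
        rintro _ ⟨i, rfl⟩
        exact mem_image_of_mem (fun y => f y x) (d n i).2.1
    have hclosed : IsClosed {y : T n | g n x ≤ f y x} :=
      isClosed_le continuous_const (continuousOn_iff_continuous_domRestrict.1
        ((hf_cont x).mono inter_subset_left))
    have hsub : range (d n) ⊆ {y : T n | g n x ≤ f y x} := by
      rintro _ ⟨i, rfl⟩
      exact ciInf_le hbdd i
    exact hclosed.closure_subset_iff.2 hsub
      (TopologicalSpace.denseRange_denseSeq (T n) ⟨y, hy⟩)
  have hgmeas : ∀ n, AEMeasurable (g n) (P.map ξ) := fun n =>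
    AEMeasurable.iInf fun i => (hf_meas _ (d n i).2.1).aemeasurable
  have hglow : ∀ n, ∀ᵐ ω ∂P, h ω ≤ g n (ξ ω) := by
    intro n
    filter_upwards [ae_all_iff.2 fun i => hhV _ (hTV n (d n i).2)] with ω hω
    exact le_ciInf hω
  have hglim : ∀ x, Tendsto (fun n => g n x) atTop (𝓝 (f y₀ x)) := by
    intro x
    refine tendsto_order.2 ⟨fun b hb => ?_, fun b hb => Eventually.of_forall fun n =>
      (hgle n y₀ (hy₀T n) x).trans_lt hb⟩
    obtain ⟨b', hbb', hb'⟩ := exists_between hb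
    obtain ⟨r, hr, hrb⟩ := Metric.mem_nhdsWithin_iff.1
      ((hf_cont x y₀ hy₀).eventually (lt_mem_nhds hb'))
    obtain ⟨n, hn⟩ := exists_nat_one_div_lt hr
    filter_upwards [eventually_ge_atTop n] with k hk
    refine hbb'.trans_le (le_ciInf fun i => ?_)
    have hlt : dist (d k i : Y) y₀ < r := (d k i).2.2.trans_le
      ((Nat.one_div_le_one_div (hk.trans (Nat.le_add_right k n₀))).trans hn.le)
    exact (hrb ⟨hlt, (d k i).2.1⟩ : b' < f (d k i) x).le
  have hbound : ∀ n, ∀ᵐ ω ∂P, ‖g n (ξ ω)‖ ≤ |h ω| + |f y₀ (ξ ω)| := by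
    intro n
    filter_upwards [hglow n] with ω hω
    have h1 := hgle n y₀ (hy₀T n) (ξ ω)
    rw [Real.norm_eq_abs, abs_le]
    constructor
    · linarith [neg_abs_le (h ω), abs_nonneg (f y₀ (ξ ω))]
    · linarith [le_abs_self (f y₀ (ξ ω)), abs_nonneg (h ω)]
  have hb_int : Integrable (fun ω => |h ω| + |f y₀ (ξ ω)|) P := hh.abs.add (hint y₀ hy₀).abs
  have hgξ : ∀ n, Integrable (fun ω => g n (ξ ω)) P := fun n => hb_int.mono'
    ((hgmeas n).comp_measurable hξ).aestronglyMeasurable (hbound n)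
  -- The envelopes converge in `L^1` as the balls shrink, and AVaR is `L^1`-Lipschitz.
  have hlim : Tendsto (fun n => ∫ ω, |f y₀ (ξ ω) - g n (ξ ω)| ∂P) atTop (𝓝 (∫ _, (0 : ℝ) ∂P)) := by
    refine tendsto_integral_of_dominated_convergence
      (fun ω => |f y₀ (ξ ω)| + (|h ω| + |f y₀ (ξ ω)|))
      (fun n => ((hint y₀ hy₀).sub (hgξ n)).abs.aestronglyMeasurable)
      ((hint y₀ hy₀).abs.add hb_int) (fun n => ?_) (Eventually.of_forall fun ω => ?_)
    · filter_upwards [hbound n] with ω hω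
      rw [Real.norm_eq_abs, abs_abs]
      exact (abs_sub _ _).trans (by gcongr; exact hω)
    · simpa using ((hglim (ξ ω)).const_sub (f y₀ (ξ ω))).abs
  rw [integral_zero] at hlim
  have hlim' := hlim.const_mul (1 / (1 - β))
  rw [mul_zero] at hlim'
  obtain ⟨n, hn⟩ := (hlim'.eventually (gt_mem_nhds hη)).exists
  refine ⟨Metric.ball y₀ (1 / (((n + n₀ : ℕ) : ℝ) + 1)), Metric.ball_mem_nhds _
    Nat.one_div_pos_of_nat, g n, ?_, fun y hy x => hgle n y ⟨hy.2, hy.1⟩ x, ?_⟩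
  · exact (integrable_map_measure (hgmeas n).aestronglyMeasurable hξ.aemeasurable).2 (hgξ n)
  · have h1 := (abs_le.1 (abs_avar_sub_avar_le hβ (hint y₀ hy₀) (hgξ n))).2
    linarith

/-- Almost surely, the empirical average value-at-risk is eventually bounded below by the true one
up to a small error, uniformly on compact sets. -/
theorem ae_eventually_sub_le_avar_empMeasure (hβ : β ∈ Ico (0 : ℝ) 1) (hξ : Measurable ξ)
    {ξs : ℕ → Ω → Ξ} (hξs : ∀ i, Measurable (ξs i)) (hindep : iIndepFun ξs P)
    (hlaw : ∀ i, P.map (ξs i) = P.map ξ) (hK : IsCompact K)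
    (hf_meas : ∀ y ∈ K, NullMeasurable (f y) (P.map ξ))
    (hf_cont : ∀ x, ContinuousOn (fun y => f y x) K)
    (hint : ∀ y ∈ K, Integrable (fun ω => f y (ξ ω)) P)
    (hlow : ∀ y₀ ∈ K, ∃ V ∈ 𝓝 y₀, ∃ h : Ω → ℝ, Integrable h P ∧
      ∀ y ∈ V ∩ K, ∀ᵐ ω ∂P, h ω ≤ f y (ξ ω))
    (hA : ContinuousOn (fun y => avar P β fun ω => f y (ξ ω)) K) :
    ∀ᵐ ω ∂P, ∀ η > 0, ∀ᶠ N in atTop, ∀ y ∈ K,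
      (avar P β fun ω => f y (ξ ω)) - η ≤ avar (empMeasure N) β fun i => f y (ξs i ω) := by
  have main : ∀ η > 0, ∀ᵐ ω ∂P, ∀ᶠ N in atTop, ∀ y ∈ K,
      (avar P β fun ω => f y (ξ ω)) - η ≤ avar (empMeasure N) β fun i => f y (ξs i ω) := by
    intro η hη
    refine hK.induction_on (p := fun S => ∀ᵐ ω ∂P, ∀ᶠ N in atTop, ∀ y ∈ S,
      (avar P β fun ω => f y (ξ ω)) - η ≤ avar (empMeasure N) β fun i => f y (ξs i ω))
      (by simp) (fun S S' hS h => ?_) (fun S S' h h' => ?_) fun y₀ hy₀ => ?_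
    · filter_upwards [h] with ω hω
      filter_upwards [hω] with N hN y hy using hN y (hS hy)
    · filter_upwards [h, h'] with ω hω hω'
      filter_upwards [hω, hω'] with N hN hN' y hy
      exact hy.elim (hN y) (hN' y)
    · obtain ⟨U, hU, g, hg, hgle, havar⟩ := exists_lower_envelope hβ hξ hK hf_meas hf_cont hint hy₀
        (hlow y₀ hy₀) (show 0 < η / 3 by positivity)
      -- The error splits in thirds: envelope against `f y₀`, empirical against true AVaR of `g`,
      -- and continuity of the true AVaR at `y₀`.
      refine ⟨_, inter_mem (inter_mem (mem_nhdsWithin_of_mem_nhds hU) self_mem_nhdsWithin)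
        ((hA y₀ hy₀).eventually (gt_mem_nhds (lt_add_of_pos_right _
          (show 0 < η / 3 by positivity)))), ?_⟩
      filter_upwards [ae_tendsto_avar_empMeasure hβ hξ hξs hindep hlaw hg] with ω hω
      filter_upwards [hω.eventually (lt_mem_nhds (sub_lt_self _
        (show 0 < η / 3 by positivity))), eventually_ge_atTop 1] with N hN hN1 y hy
      have := isProbabilityMeasure_empMeasure hN1
      have h1 := avar_mono hβ (integrable_empMeasure N fun i => g (ξs i ω))
        (integrable_empMeasure N fun i => f y (ξs i ω)) fun i => hgle y hy.1 _
      have h2 : (avar P β fun ω => f y (ξ ω)) < (avar P β fun ω => f y₀ (ξ ω)) + η / 3 := hy.2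
      linarith
  -- Countably many tolerances make the exceptional null set independent of `η`.
  filter_upwards [ae_all_iff.2 fun j : ℕ => main (1 / ((j : ℝ) + 1)) Nat.one_div_pos_of_nat]
    with ω hω η hη
  obtain ⟨j, hj⟩ := exists_nat_one_div_lt hη
  filter_upwards [hω j] with N hN y hy
  linarith [hN y hy]

end EpigraphicalLaw

/-! ### Continuity of true and empirical risk in `y`. -/

section Continuity

theorem integral_abs_sub_le_dist_toLp {Ω : Type*} [MeasurableSpace Ω] {P : Measure Ω}
    [IsProbabilityMeasure P] {p : ℝ≥0∞} [hp : Fact (1 ≤ p)] {X X' : Ω → ℝ} (hX : MemLp X p P)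
    (hX' : MemLp X' p P) : ∫ ω, |X ω - X' ω| ∂P ≤ dist (hX.toLp X) (hX'.toLp X') := by
  have hsub := hX.sub hX'
  have h1 : ∫ ω, |X ω - X' ω| ∂P = (eLpNorm (X - X') 1 P).toReal := by
    rw [eLpNorm_one_eq_lintegral_enorm, ← integral_norm_eq_lintegral_enorm hsub.1]
    rfl
  rw [h1, dist_eq_norm, ← MemLp.toLp_sub, Lp.norm_toLp]
  exact ENNReal.toReal_mono hsub.2.ne (eLpNorm_le_eLpNorm_of_exponent_le hp.out hsub.1)

variable {Ω Ξ Y : Type*} [MeasurableSpace Ω] {P : Measure Ω} [IsProbabilityMeasure P]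
  {ξ : Ω → Ξ} [TopologicalSpace Y] {Y₀ : Set Y} {f : Y → Ξ → ℝ} {β : ℝ}

theorem continuousOn_avar_comp (hβ : β ∈ Ico (0 : ℝ) 1) {p : ℝ≥0∞} [hp : Fact (1 ≤ p)]
    (hF : ∀ y ∈ Y₀, MemLp (fun ω => f y (ξ ω)) p P)
    (hF_cont : Continuous fun y : Y₀ => (hF y.1 y.2).toLp (fun ω => f y.1 (ξ ω))) :
    ContinuousOn (fun y => avar P β fun ω => f y (ξ ω)) Y₀ := by
  rw [continuousOn_iff_continuous_domRestrict, continuous_iff_continuousAt]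
  intro y
  refine tendsto_iff_dist_tendsto_zero.2 ?_
  have h1 := (tendsto_iff_dist_tendsto_zero.1 (hF_cont.tendsto y)).const_mul (1 / (1 - β))
  rw [mul_zero] at h1
  refine squeeze_zero (fun _ => dist_nonneg) (fun y' => ?_) h1
  refine (abs_avar_sub_avar_le hβ ((hF _ y'.2).integrable hp.out)
    ((hF _ y.2).integrable hp.out)).trans ?_
  exact mul_le_mul_of_nonneg_left (integral_abs_sub_le_dist_toLp (hF _ y'.2) (hF _ y.2))
    (zero_le_one.trans (one_le_one_div_one_sub hβ))

theorem continuousOn_smoothedAvar_empMeasure (hβ : β ∈ Ico (0 : ℝ) 1) {ε : ℝ} (hε : 0 < ε)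
    (hf_cont : ∀ x, ContinuousOn (fun y => f y x) Y₀) {N : ℕ} (hN : 1 ≤ N) (x : ℕ → Ξ) :
    ContinuousOn (fun y => smoothedAvar (empMeasure N) β ε fun i => f y (x i)) Y₀ := by
  have := isProbabilityMeasure_empMeasure hN
  intro y hy
  refine tendsto_iff_dist_tendsto_zero.2 ?_
  have h1 : Tendsto (fun y' => 1 / (1 - β) *
      ((∑ i ∈ Finset.range N, |f y' (x i) - f y (x i)|) / N)) (𝓝[Y₀] y) (𝓝 0) := by
    have h2 : ContinuousWithinAt (fun y' => 1 / (1 - β) *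
        ((∑ i ∈ Finset.range N, |f y' (x i) - f y (x i)|) / N)) Y₀ y := by
      refine ContinuousWithinAt.const_mul (ContinuousWithinAt.div_const ?_ _) _
      exact tendsto_finsetSum _ fun i _ => ((hf_cont (x i) y hy).sub continuousWithinAt_const).abs
    simpa using h2.tendsto
  refine squeeze_zero (fun _ => dist_nonneg) (fun y' => ?_) h1
  rw [← integral_empMeasure]
  exact abs_smoothedAvar_sub_smoothedAvar_le hβ hε (integrable_empMeasure N _)
    (integrable_empMeasure N _)

end Continuity

end RiskConsistency

/-! ### Assembly of the consistency result. -/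

theorem mainTheorem6
    {Ω Ξ Z Y : Type*}
    -- the probability space
    [MeasurableSpace Ω] (P : Measure Ω) [IsProbabilityMeasure P]
    (hP_complete : P.IsComplete) (hP_nonatomic : Nonatomic P)
    -- the sample space, the random element and the samples
    [MetricSpace Ξ] [CompleteSpace Ξ] [TopologicalSpace.SeparableSpace Ξ]
    [MeasurableSpace Ξ] [BorelSpace Ξ]
    (ξ : Ω → Ξ) (hξ : Measurable ξ)
    (ξs : ℕ → Ω → Ξ) (hξs : ∀ i, Measurable (ξs i))
    (hξs_indep : iIndepFun ξs P) (hξs_law : ∀ i, P.map (ξs i) = P.map ξ)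
    -- the spaces and the feasible set
    [NormedAddCommGroup Z] [NormedSpace ℝ Z] [CompleteSpace Z]
    [TopologicalSpace.SeparableSpace Z] (hZ : ReflexiveSpace Z)
    (Zad : Set Z) (hZad_ne : Zad.Nonempty) (hZad_closed : IsClosed Zad)
    (hZad_convex : Convex ℝ Zad) (hZad_bdd : Bornology.IsBounded Zad)
    [NormedAddCommGroup Y] [NormedSpace ℝ Y] [CompleteSpace Y]
    (Y₀ : Set Y) (hY₀ : IsClosed Y₀)
    (p : ℝ≥0∞) [Fact (1 ≤ p)] (hp : p ≠ ∞)
    -- the linear, completely continuous operator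
    (B : Z →ₗ[ℝ] Y) (hB : CompletelyContinuous B) (hB_maps : MapsTo B Zad Y₀)
    -- the deterministic cost
    (wp : Z → ℝ) (hwp_nonneg : ∀ z, 0 ≤ wp z) (hwp_convex : ConvexOn ℝ univ wp)
    (hwp_cont : Continuous wp)
    -- the Carathéodory integrand on `Y₀ × Ξ`; measurability in the second variable is with respect
    -- to the Borel σ-algebra completed under the law of `ξ`
    (f : Y → Ξ → ℝ) (hf_meas : ∀ y ∈ Y₀, NullMeasurable (f y) (P.map ξ))
    (hf_cont : ∀ x : Ξ, ContinuousOn (fun y => f y x) Y₀)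
    -- `F : Y₀ → L^p` is well defined and continuous
    (hF : ∀ y ∈ Y₀, MemLp (fun ω => f y (ξ ω)) p P)
    (hF_cont : Continuous fun y : Y₀ => (hF y.1 y.2).toLp (fun ω => f y.1 (ξ ω)))
    -- local lower bounds in `L^p`
    (hf_lower : ∀ y₀ ∈ Y₀, ∃ V ∈ 𝓝 y₀, ∃ h : Ω → ℝ, MemLp h p P ∧
      ∀ y ∈ V ∩ Y₀, ∀ᵐ ω ∂P, h ω ≤ f y (ξ ω))
    -- the risk level and the smoothing parameters
    (β : ℝ) (hβ : β ∈ Ico (0 : ℝ) 1)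
    (ε : ℕ → ℝ) (hε_pos : ∀ N, 0 < ε N) (hε : Tendsto ε atTop (𝓝 0)) :
    -- the limiting optimal value is finite and the solution sets are nonempty
    (optVal (trueObj P β ξ f B wp) Zad ≠ ⊥ ∧ optVal (trueObj P β ξ f B wp) Zad ≠ ⊤) ∧
    (solSet (trueObj P β ξ f B wp) Zad).Nonempty ∧
    (∀ᵐ ω ∂P, ∀ N : ℕ, 1 ≤ N →
      (solSet (smoothedEmpObj P p β (ε N) ξs f B wp N ω) Zad).Nonempty) ∧
    -- consistency of the optimal values
    (∀ᵐ ω ∂P, Tendsto (fun N : ℕ => optVal (smoothedEmpObj P p β (ε N) ξs f B wp N ω) Zad)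
      atTop (𝓝 (optVal (trueObj P β ξ f B wp) Zad))) ∧
    -- consistency of the solution sets
    (IsRFunction wp →
      ∀ᵐ ω ∂P, Tendsto (fun N : ℕ => deviation
          (solSet (smoothedEmpObj P p β (ε N) ξs f B wp N ω) Zad)
          (solSet (trueObj P β ξ f B wp) Zad))
        atTop (𝓝 0)) := by
  set A : Y → ℝ := fun y => avar P β fun ω => f y (ξ ω)
  set Â : ℕ → Ω → Y → ℝ := fun N ω y =>
    smoothedAvar (empMeasure N) β (ε N) fun i => f y (ξs i ω)
  have hint : ∀ y ∈ Y₀, Integrable (fun ω => f y (ξ ω)) P := fun y hy =>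
    (hF y hy).integrable Fact.out
  have hA : ContinuousOn A Y₀ := continuousOn_avar_comp hβ hF hF_cont
  have hK : IsCompact (B '' Zad) := hZ.isCompact_image hZad_bdd hZad_convex hZad_closed hB
  have hKY : B '' Zad ⊆ Y₀ := hB_maps.image_subset
  have hemp : ∀ N ω, 1 ≤ N → smoothedEmpObj P p β (ε N) ξs f B wp N ω
      = fun z => Â N ω (B z) + wp z := fun N ω hN => funext fun z =>
    congrArg (· + wp z) (riskAt_smoothedAvar_empDistFun hP_nonatomic hN p β (ε N) _)
  have hemp_min : ∀ N ω, 1 ≤ N →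
      ∃ z ∈ Zad, ∀ z' ∈ Zad, Â N ω (B z) + wp z ≤ Â N ω (B z') + wp z' := fun N ω hN =>
    hZ.exists_minimizer hZad_ne hZad_bdd hZad_convex hZad_closed hB
      ((continuousOn_smoothedAvar_empMeasure hβ (hε_pos N) hf_cont hN _).mono hKY)
      hwp_nonneg hwp_convex hwp_cont
  obtain ⟨zs, hzs, hzs_min⟩ := hZ.exists_minimizer hZad_ne hZad_bdd hZad_convex hZad_closed hB
    (hA.mono hKY) hwp_nonneg hwp_convex hwp_cont
  set m := A (B zs) + wp zs
  have htrue : trueObj P β ξ f B wp = fun z => A (B z) + wp z := rfl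
  have hopt : optVal (trueObj P β ξ f B wp) Zad = (m : EReal) := optVal_eq_of_isMin hzs hzs_min
  -- the empirical objective is eventually bounded below by the true one, up to a small error
  have hlower : ∀ᵐ ω ∂P, ∀ η > 0, ∀ᶠ N in atTop, ∀ z ∈ Zad,
      A (B z) + wp z - η ≤ Â N ω (B z) + wp z := by
    filter_upwards [ae_eventually_sub_le_avar_empMeasure hβ hξ hξs hξs_indep hξs_law hK
      (fun y hy => hf_meas y (hKY hy)) (fun x => (hf_cont x).mono hKY)
      (fun y hy => hint y (hKY hy)) (fun y hy => by
        obtain ⟨V, hV, h, hh, hle⟩ := hf_lower y (hKY hy)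
        exact ⟨V, hV, h, hh.integrable Fact.out, fun y' hy' => hle y' ⟨hy'.1, hKY hy'.2⟩⟩)
      (hA.mono hKY)] with ω hω η hη
    filter_upwards [hω η hη, eventually_ge_atTop 1] with N hN hN1 z hz
    have := isProbabilityMeasure_empMeasure hN1
    have h1 := hN (B z) (mem_image_of_mem B hz)
    have h2 := avar_le_smoothedAvar hβ (hε_pos N)
      (integrable_empMeasure N fun i => f (B z) (ξs i ω))
    linarith
  -- and it is eventually not much larger at a solution of the true problem
  have hupper : ∀ᵐ ω ∂P, ∀ η > 0, ∀ᶠ N in atTop, Â N ω (B zs) + wp zs < m + η := by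
    have hg : Integrable (f (B zs)) (P.map ξ) :=
      (integrable_map_measure (hf_meas _ (hB_maps hzs)).aemeasurable.aestronglyMeasurable
        hξ.aemeasurable).2 (hint _ (hB_maps hzs))
    filter_upwards [ae_tendsto_avar_empMeasure hβ hξ hξs hξs_indep hξs_law hg] with ω hω η hη
    have hlim : Tendsto (fun N => (avar (empMeasure N) β fun i => f (B zs) (ξs i ω))
        + 1 / (1 - β) * (ε N * Real.log 2)) atTop (𝓝 (A (B zs))) := by
      simpa using hω.add ((hε.mul_const (Real.log 2)).const_mul (1 / (1 - β)))
    filter_upwards [hlim.eventually (gt_mem_nhds (lt_add_of_pos_right _ hη)),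
      eventually_ge_atTop 1] with N hN hN1
    have := isProbabilityMeasure_empMeasure hN1
    have h1 := smoothedAvar_le_avar_add hβ (hε_pos N)
      (integrable_empMeasure N fun i => f (B zs) (ξs i ω))
    linarith
  refine ⟨?_, ⟨zs, mem_solSet_iff.2 ⟨hzs, hzs_min⟩⟩, Eventually.of_forall fun ω N hN => ?_, ?_, ?_⟩
  · rw [hopt]
    exact ⟨EReal.coe_ne_bot _, EReal.coe_ne_top _⟩
  · obtain ⟨z, hz, hmin⟩ := hemp_min N ω hN
    rw [hemp N ω hN]
    exact ⟨z, mem_solSet_iff.2 ⟨hz, hmin⟩⟩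
  · filter_upwards [hlower, hupper] with ω hlo hup
    choose! z hz hz_min using fun N => hemp_min N ω
    have hreal : Tendsto (fun N => Â N ω (B (z N)) + wp (z N)) atTop (𝓝 m) := by
      refine Metric.tendsto_nhds.2 fun η hη => ?_
      filter_upwards [hlo (η / 2) (half_pos hη), hup η hη, eventually_ge_atTop 1]
        with N h1 h2 hN
      -- True optimality and the lower bound give `m - η / 2 ≤` the empirical value; comparison with
      -- the fixed competitor `zs` bounds that value above.
      have h3 := h1 _ (hz N hN)
      have h4 := hz_min N hN zs hzs
      have h5 := hzs_min _ (hz N hN)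
      rw [Real.dist_eq, abs_lt]
      constructor <;> linarith
    rw [hopt]
    refine (continuous_coe_real_ereal.continuousAt.tendsto.comp hreal).congr' ?_
    filter_upwards [eventually_ge_atTop 1] with N hN
    rw [hemp N ω hN]
    exact (optVal_eq_of_isMin (J := fun z => Â N ω (B z) + wp z) (hz N hN) (hz_min N hN)).symm
  · intro hR
    filter_upwards [hlower, hupper] with ω hlo hup
    rw [ENNReal.tendsto_nhds_zero]
    intro δ hδ
    obtain ⟨r, hr0, hrδ⟩ : ∃ r : ℝ, 0 < r ∧ ENNReal.ofReal r ≤ δ := by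
      obtain ⟨r, -, hr0, hrδ⟩ := ENNReal.lt_iff_exists_real_btwn.1 hδ
      exact ⟨r, ENNReal.ofReal_pos.1 hr0, hrδ.le⟩
    obtain ⟨η, hη, hnear⟩ := hZ.exists_near_minimizer hZad_bdd hZad_convex hZad_closed hB
      (hA.mono hKY) hR hzs_min hr0
    filter_upwards [hlo (η / 2) (half_pos hη), hup (η / 2) (half_pos hη), eventually_ge_atTop 1]
      with N h1 h2 hN
    refine (deviation_le fun z hz => ?_).trans hrδ
    rw [hemp N ω hN, mem_solSet_iff] at hz
    -- An empirical minimizer is an `η`-minimizer of the true problem: half of `η` is lost in the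
    -- lower bound at `z`, half in the upper bound at `zs`.
    have h3 := h1 z hz.1
    have h4 := hz.2 zs hzs
    obtain ⟨z', hz', hval, hdist⟩ := hnear z hz.1 (by linarith)
    refine ⟨z', mem_solSet_iff.2 ⟨hz', fun z'' hz'' => ?_⟩, hdist.le⟩
    rw [htrue]
    exact hval.le.trans (hzs_min z'' hz'')
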